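/- Let $K$ be a field of characteristic $0$. For a pair of compositions $\lambda,\mu$ of $n\ge 0$, the meander $\frac{\lambda}{\mu}$ is the planar graph on $n$ collinear nodes whose upper (respectively lower) arcs join, in a nested fashion, the nodes inside each block of consecutive nodes determined by the parts of $\lambda$ (respectively $\mu$). Its seaweed algebra $\mathfrak p_n\frac{\lambda}{\mu}\subseteq\mathfrak{gl}_n(K)$ is the Lie algebra of all $n\times n$ matrices whose nonzero entries above the diagonal lie in the diagonal blocks with sizes given by $\lambda$ and whose nonzero entries below the diagonal lie in the diagonal blocks with sizes given by $\mu$. The index of the meander is the index of this Lie algebra, $$\mathrm{ind}(\tfrac{\lambda}{\mu})=\min_{\varphi\in\mathfrak g^*}\dim\{u\in\mathfrak g:\varphi([u,v])=0\ \text{for all } v\in\mathfrak g\},\qquad \mathfrak g=\mathfrak p_n\tfrac{\lambda}{\mu}.$$ For a set $J$ of positive integers, let $a^J_{n,k}$ be the number of meanders $\frac{\lambda}{\mu}$ on $n$ nodes with index $k$ such that all parts of $\lambda$ and $\mu$ belong to $J$, and let $A_J(x,y)=\sum_{n,k\ge 0}a^J_{n,k}x^ny^k\in\mathbb Z[[x,y]]$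 (the empty meander contributes $1$). **Theorem.** In $\mathbb Z[[x,y]]$ one has $A_{\{1,3,4\}}(x,y)=\dfrac{f}{g}$, where $$\begin{aligned} f&=1-2x+2x^2-2x^3+x^4-x^2y,\\ g&=1-x(2+y)+x^2(2+y)-x^3(2+2y+y^2+y^3)+x^4(1-2y+2y^3-y^4)\\ &\quad+x^5(5y-2y^3+3y^4)+x^6(-4y+2y^3-2y^4+y^5)+x^7(2y-y^3+2y^4)-x^8y^4, \end{aligned}$$ and for every integer $c\ge 1$, $$A_{\{c,3c,4c\}}(x,y)=A_{\{1,3,4\}}(x^c,y^c).$$ -/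

import Mathlib

namespace SeaweedMeander

open MvPowerSeries

-- The bracket on matrices is the commutator.
attribute [local instance] LieRing.ofAssociativeRing

section LieIndex

variable (K : Type*) [Field K] (L : Type*) [LieRing L] [LieAlgebra K L]

/-- The stabilizer `{x ∈ L | f ⁅x, y⁆ = 0 for all y ∈ L}` of a linear form `f` on `L` under the
coadjoint action. -/
def coadjointStabilizer (f : Module.Dual K L) : Submodule K L where
  carrier := {x | ∀ y : L, f ⁅x, y⁆ = 0}
  zero_mem' := by
    intro y
    simp
  add_mem' := by
    intro a b ha hb y
    rw [add_lie, map_add, ha y, hb y, add_zero]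
  smul_mem' := by
    intro t a ha y
    rw [smul_lie, map_smul, ha y, smul_zero]

/-- The index of a (finite-dimensional) Lie algebra: the minimal dimension of the stabilizer of a
linear form under the coadjoint action. -/
noncomputable def lieIndex : ℕ :=
  ⨅ f : Module.Dual K L, Module.finrank K (coadjointStabilizer K L f)

end LieIndex

theorem index_mono {n : ℕ} (lam : Composition n) : Monotone lam.index := by
  intro i j hij
  by_contra! h
  have h1 : lam.sizeUpTo (lam.index j).succ ≤ lam.sizeUpTo (lam.index i) :=
    lam.monotone_sizeUpTo (by simpa using h)
  have h2 := lam.lt_sizeUpTo_index_succ j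
  have h3 := lam.sizeUpTo_index_le i
  have h4 : (i : ℕ) ≤ j := hij
  omega

/-- The pairs `(lam, mu)` of compositions of `n`, standing for the meander `lam / mu` on `n` nodes
whose upper arcs are dictated by `lam` and whose lower arcs are dictated by `mu`. -/
abbrev Meander (n : ℕ) : Type := Composition n × Composition n

/-- The matrices whose nonzero entries above the diagonal lie in the diagonal blocks with sizes
given by `m.1`, and whose nonzero entries below the diagonal lie in the diagonal blocks with sizes
given by `m.2`. They are closed under matrix multiplication. -/
def seaweedSubalgebra (K : Type*) [Field K] {n : ℕ} (m : Meander n) :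
    Subalgebra K (Matrix (Fin n) (Fin n) K) where
  carrier := {M | ∀ i j : Fin n, M i j ≠ 0 →
    (i < j → m.1.index i = m.1.index j) ∧ (j < i → m.2.index i = m.2.index j)}
  mul_mem' := by
    intro A B hA hB i j hij
    rw [Matrix.mul_apply] at hij
    obtain ⟨k, -, hk⟩ := Finset.exists_ne_zero_of_sum_ne_zero hij
    obtain ⟨a1, a2⟩ := hA i k (left_ne_zero_of_mul hk)
    obtain ⟨b1, b2⟩ := hB k j (right_ne_zero_of_mul hk)
    constructor
    · intro h
      rcases lt_trichotomy i k with hik | rfl | hik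
      · have e := a1 hik
        refine le_antisymm (index_mono _ h.le) ?_
        rcases lt_or_ge k j with hkj | hkj
        · rw [e, b1 hkj]
        · rw [e]
          exact index_mono _ hkj
      · exact b1 h
      · exact le_antisymm (index_mono _ h.le)
          ((b1 (hik.trans h)) ▸ index_mono _ hik.le)
    · intro h
      rcases lt_trichotomy k i with hki | rfl | hki
      · have e := a2 hki
        rcases lt_or_ge j k with hjk | hjk
        · rw [e, b2 hjk]
        · refine le_antisymm ?_ (index_mono _ h.le)
          rw [e]
          exact index_mono _ hjk
      · exact b2 h
      · exact le_antisymm ((b2 (h.trans hki)) ▸ index_mono _ hki.le)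
          (index_mono _ h.le)
  add_mem' := by
    intro A B hA hB i j hij
    by_cases h : A i j = 0
    · refine hB i j ?_
      intro h'
      exact hij (by simp [h, h'])
    · exact hA i j h
  algebraMap_mem' := by
    intro r i j hij
    have e : i = j := by
      by_contra h
      exact hij (by simp [Matrix.algebraMap_matrix_apply, h])
    subst e
    simp

/-- The seaweed Lie algebra of the meander `m`, a Lie subalgebra of `𝔤𝔩ₙ(K)` with the commutator
bracket. -/
abbrev seaweed (K : Type*) [Field K] {n : ℕ} (m : Meander n) :
    LieSubalgebra K (Matrix (Fin n) (Fin n) K) :=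
  lieSubalgebraOfSubalgebra K (Matrix (Fin n) (Fin n) K) (seaweedSubalgebra K m)

/-- The index of a meander: the index of its seaweed Lie algebra. -/
noncomputable def meanderIndex (K : Type*) [Field K] {n : ℕ} (m : Meander n) : ℕ :=
  lieIndex K (seaweed K m)

/-- The number of meanders on `n` nodes, with all parts in `J`, that have index `k`. -/
noncomputable def meanderCount (K : Type*) [Field K] (J : Set ℕ) (n k : ℕ) : ℕ :=
  Nat.card {m : Meander n //
    (∀ p ∈ m.1.blocks, p ∈ J) ∧ (∀ p ∈ m.2.blocks, p ∈ J) ∧ meanderIndex K m = k}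

/-- The generating function `A_J(x, y) = ∑ a_{n,k} x ^ n y ^ k` of the meanders with parts in `J`
by length and index; the variable `x` is `X 0` and the variable `y` is `X 1`. -/
noncomputable def meanderSeries (K : Type*) [Field K] (J : Set ℕ) : MvPowerSeries (Fin 2) ℤ :=
  fun d => (meanderCount K J (d 0) (d 1) : ℤ)

/-- The numerator `f`. -/
noncomputable def numer134 : MvPowerSeries (Fin 2) ℤ :=
  let x : MvPowerSeries (Fin 2) ℤ := X 0
  let y : MvPowerSeries (Fin 2) ℤ := X 1
  1 - 2 * x + 2 * x ^ 2 - 2 * x ^ 3 + x ^ 4 - x ^ 2 * y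

/-- The denominator `g`. -/
noncomputable def denom134 : MvPowerSeries (Fin 2) ℤ :=
  let x : MvPowerSeries (Fin 2) ℤ := X 0
  let y : MvPowerSeries (Fin 2) ℤ := X 1
  1 - x * (2 + y) + x ^ 2 * (2 + y) - x ^ 3 * (2 + 2 * y + y ^ 2 + y ^ 3)
    + x ^ 4 * (1 - 2 * y + 2 * y ^ 3 - y ^ 4)
    + x ^ 5 * (5 * y - 2 * y ^ 3 + 3 * y ^ 4)
    + x ^ 6 * (-4 * y + 2 * y ^ 3 - 2 * y ^ 4 + y ^ 5)
    + x ^ 7 * (2 * y - y ^ 3 + 2 * y ^ 4) - x ^ 8 * y ^ 4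

end SeaweedMeander

/-! A seaweed algebra is the incidence algebra of a preorder on the nodes, and its index obeys
Euclid-like rules on the first upper part a and the first lower part b, up to exchanging the sides.
If a = b, a copy of gl_a splits off and contributes a. If 2a ≤ b, then a is deleted and b is
replaced by the two parts b - 2a, a. If a < b < 2a, then a becomes 2a - b and b becomes a.

The last two rules are symplectic reductions. Let I be the set of the first a nodes. The matrices
with rows outside I and columns inside I form an abelian ideal V. For a form whose restriction to V
is given by a partial matching of nodes, the orthogonal of V modulo V is the smaller seaweed
algebra, and the stabilizers of the form and of its restriction have the same dimension
(`IsReduction.finrank_comp_embed`). Over an infinite field a generic form can be conjugated into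
this position without enlarging its stabilizer beyond the minimum, so the indices agree
(`IsReduction.lieIndex_eq`).

Two consequences give the theorem. The rules are homogeneous, so multiplying all parts by c
multiplies the index by c (`listIndex_map_mul`); this is the substitution of x^c, y^c. And when
parts 1, 3, 4 are consumed from the left, the unmatched remainder on one side is always one of [],
[1], [1,1], [2,1], [3], [4]. The meanders are thus counted by a finite transfer system, whose
solution is f / g (`series_pendingCount_nil_mul_denom134`). -/

namespace SeaweedMeander

open MvPowerSeries

attribute [local instance] LieRing.ofAssociativeRing

set_option linter.unusedSectionVars false

/-! ### Index of a Lie algebra: symplectic reduction, semicontinuity, additivity. -/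

section IndexGeneral

variable {K : Type*} [Field K] {L : Type*} [LieRing L] [LieAlgebra K L]
  {M : Type*} [LieRing M] [LieAlgebra K M]

theorem mem_coadjointStabilizer {f : Module.Dual K L} {x : L} :
    x ∈ coadjointStabilizer K L f ↔ ∀ y, f ⁅x, y⁆ = 0 := Iff.rfl

theorem lieIndex_le (f : Module.Dual K L) :
    lieIndex K L ≤ Module.finrank K (coadjointStabilizer K L f) :=
  ciInf_le' _ f

variable (K L) in
theorem exists_finrank_coadjointStabilizer_eq_lieIndex :
    ∃ f : Module.Dual K L, Module.finrank K (coadjointStabilizer K L f) = lieIndex K L :=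
  Nat.sInf_mem (Set.range_nonempty _)

/-- The alternating form `(x, y) ↦ f ⁅x, y⁆` of a linear form `f`. -/
def kirillovForm (f : Module.Dual K L) : L →ₗ[K] Module.Dual K L :=
  LinearMap.mk₂ K (fun x y => f ⁅x, y⁆) (by simp) (by simp) (by simp) (by simp)

theorem kirillovForm_apply (f : Module.Dual K L) (x y : L) : kirillovForm f x y = f ⁅x, y⁆ := rfl

theorem ker_kirillovForm (f : Module.Dual K L) :
    LinearMap.ker (kirillovForm f) = coadjointStabilizer K L f := by
  ext x
  rw [LinearMap.mem_ker, mem_coadjointStabilizer]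
  exact LinearMap.ext_iff

/-- Symplectic reduction of the form `f ⁅x, y⁆` along an isotropic subspace `V` that meets the
stabilizer of `f` trivially and whose orthogonal is spanned by `V` and the image of `s`. -/
theorem finrank_coadjointStabilizer_comp [FiniteDimensional K L] (s : M →ₗ⁅K⁆ L)
    (V : Submodule K L) (f : Module.Dual K L)
    (nondegenerate : ∀ v ∈ V, (∀ x : L, f ⁅x, v⁆ = 0) → v = 0)
    (orthogonal : ∀ x : L, (∀ v ∈ V, f ⁅x, v⁆ = 0) → ∃ v ∈ V, ∃ m, x = v + s m)
    (image : ∀ m, ∀ v ∈ V, f ⁅s m, v⁆ = 0)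
    (disjoint : ∀ m, s m ∈ V → m = 0) :
    Module.finrank K (coadjointStabilizer K M (f ∘ₗ (s : M →ₗ[K] L))) =
      Module.finrank K (coadjointStabilizer K L f) := by
  set S := coadjointStabilizer K L f
  set T := coadjointStabilizer K M (f ∘ₗ (s : M →ₗ[K] L))
  have skew : ∀ x y : L, f ⁅x, y⁆ = 0 → f ⁅y, x⁆ = 0 := by
    intro x y h
    rw [← lie_skew, map_neg, h, neg_zero]
  have inj : Function.Injective (s : M →ₗ[K] L) := by
    rw [← LinearMap.ker_eq_bot, LinearMap.ker_eq_bot']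
    intro m hm
    refine disjoint m ?_
    have : s m = 0 := hm
    rw [this]
    exact V.zero_mem
  have hT : Module.finrank K (T.map (s : M →ₗ[K] L)) = Module.finrank K T :=
    (Submodule.equivMapOfInjective _ inj T).finrank_eq.symm
  have hSV : S ⊓ V = ⊥ := by
    rw [eq_bot_iff]
    rintro x ⟨h1, h2⟩
    exact nondegenerate x h2 fun y => skew _ _ (h1 y)
  have hTV : T.map (s : M →ₗ[K] L) ⊓ V = ⊥ := by
    rw [eq_bot_iff]
    rintro x ⟨⟨m, -, rfl⟩, h2⟩
    have := disjoint m h2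
    subst this
    simp
  -- Both sums are direct by `hSV` and `hTV`, so equality of the sums gives equality of the
  -- dimensions of `S` and `T`.
  have hsup : S ⊔ V = T.map (s : M →ₗ[K] L) ⊔ V := by
    apply le_antisymm
    · refine sup_le ?_ le_sup_right
      intro x hx
      obtain ⟨v, hv, m, rfl⟩ := orthogonal x fun v _ => hx v
      rw [add_comm]
      refine Submodule.add_mem_sup ⟨m, ?_, rfl⟩ hv
      intro m'
      have h1 := hx (s m')
      rw [add_lie, map_add, skew _ _ (image m' v hv), zero_add, ← LieHom.map_lie] at h1
      exact h1
    · refine sup_le ?_ le_sup_right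
      rintro x ⟨m, hm, rfl⟩
      -- Some `v` in `V` induces the same functional as `s m`, so that `s m - v` stabilizes `f`. By
      -- double annihilators it suffices that this functional vanishes on the orthogonal of `V`,
      -- which lies in `V` plus the image of `s`: on `V` by `image`, on the image because `m` lies
      -- in `T`.
      have key : kirillovForm f (s m) ∈ V.map (kirillovForm f) := by
        rw [← Subspace.dualCoannihilator_dualAnnihilator_eq (W := V.map (kirillovForm f)),
          Submodule.mem_dualAnnihilator]
        intro y hy
        rw [Submodule.mem_dualCoannihilator] at hy
        have hy' : ∀ v ∈ V, f ⁅y, v⁆ = 0 := fun v hv => skew _ _ (hy _ ⟨v, hv, rfl⟩)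
        obtain ⟨v, hv, m', rfl⟩ := orthogonal y hy'
        rw [kirillovForm_apply, lie_add, map_add, image m v hv, zero_add, ← LieHom.map_lie]
        exact hm m'
      obtain ⟨v, hv, hvm⟩ := key
      have : (s : M →ₗ[K] L) m = (s m - v) + v := by simp
      rw [this]
      refine Submodule.add_mem_sup ?_ hv
      intro y
      rw [sub_lie, map_sub, ← kirillovForm_apply, ← kirillovForm_apply, hvm, sub_self]
  have e1 := Submodule.finrank_sup_add_finrank_inf_eq S V
  have e2 := Submodule.finrank_sup_add_finrank_inf_eq (T.map (s : M →ₗ[K] L)) V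
  rw [hSV, finrank_bot] at e1
  rw [hTV, finrank_bot] at e2
  rw [hsup] at e1
  omega

theorem finrank_coadjointStabilizer_comp_equiv (e : M ≃ₗ⁅K⁆ L) (f : Module.Dual K L) :
    Module.finrank K (coadjointStabilizer K M (f ∘ₗ ((e : M →ₗ⁅K⁆ L) : M →ₗ[K] L))) =
      Module.finrank K (coadjointStabilizer K L f) := by
  have h : (coadjointStabilizer K M (f ∘ₗ ((e : M →ₗ⁅K⁆ L) : M →ₗ[K] L))).map
      (e.toLinearEquiv : M →ₗ[K] L) = coadjointStabilizer K L f := by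
    ext x
    constructor
    · rintro ⟨m, hm, rfl⟩ y
      have h1 : f (e ⁅m, e.symm y⁆) = 0 := hm (e.symm y)
      rw [LieEquiv.map_lie, LieEquiv.apply_symm_apply] at h1
      exact h1
    · intro hx
      refine ⟨e.symm x, ?_, e.apply_symm_apply x⟩
      intro y
      change f (e ⁅e.symm x, y⁆) = 0
      rw [LieEquiv.map_lie, LieEquiv.apply_symm_apply]
      exact hx _
  rw [← h]
  exact (LinearEquiv.finrank_map_eq e.toLinearEquiv _).symm

theorem lieIndex_congr (e : M ≃ₗ⁅K⁆ L) : lieIndex K M = lieIndex K L := by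
  apply le_antisymm
  · obtain ⟨f, hf⟩ := exists_finrank_coadjointStabilizer_eq_lieIndex K L
    rw [← hf, ← finrank_coadjointStabilizer_comp_equiv e f]
    exact lieIndex_le _
  · obtain ⟨f, hf⟩ := exists_finrank_coadjointStabilizer_eq_lieIndex K M
    rw [← hf, ← finrank_coadjointStabilizer_comp_equiv e.symm f]
    exact lieIndex_le _

/-- Semicontinuity of the rank along a line. On a complement `C` of `ker B` the map `B` has a left
inverse `P`; if `ker (A + t B)` meets `C`, then `-t` is an eigenvalue of `P A` on `C`, which happens
for finitely many `t`. For all other `t` the kernel is disjoint from `C`, hence no larger than `ker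
B`. -/
theorem finite_setOf_finrank_ker_lt {E F : Type*} [AddCommGroup E] [Module K E] [AddCommGroup F]
    [Module K F] [FiniteDimensional K E] (A B : E →ₗ[K] F) :
    {t : K | Module.finrank K (LinearMap.ker B) <
      Module.finrank K (LinearMap.ker (A + t • B))}.Finite := by
  obtain ⟨C, hC⟩ := Submodule.exists_isCompl (LinearMap.ker B)
  have hinj : LinearMap.ker (B ∘ₗ C.subtype) = ⊥ := by
    rw [LinearMap.ker_eq_bot']
    intro c hc
    have : (c : E) ∈ LinearMap.ker B ⊓ C := ⟨hc, c.2⟩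
    rw [hC.inf_eq_bot, Submodule.mem_bot] at this
    exact Subtype.ext this
  obtain ⟨P, hP⟩ := LinearMap.exists_leftInverse_of_injective _ hinj
  let T : Module.End K C := P ∘ₗ A ∘ₗ C.subtype
  refine ((Module.End.finite_hasEigenvalue T).image fun t => -t).subset ?_
  intro t ht
  by_contra hT
  have hT' : ¬ T.HasEigenvalue (-t) := fun h => hT ⟨-t, h, neg_neg t⟩
  have hd : Disjoint (LinearMap.ker (A + t • B)) C := by
    rw [Submodule.disjoint_def]
    intro x hx hxC
    by_contra hx0
    apply hT'
    refine Module.End.hasEigenvalue_of_hasEigenvector (x := (⟨x, hxC⟩ : C)) ⟨?_, ?_⟩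
    · rw [Module.End.mem_eigenspace_iff]
      have h1 : P (A x + t • B x) = 0 := by
        have : A x + t • B x = 0 := hx
        rw [this, map_zero]
      have h2 : P (B x) = ⟨x, hxC⟩ := LinearMap.congr_fun hP ⟨x, hxC⟩
      rw [map_add, map_smul, h2] at h1
      rw [neg_smul]
      exact eq_neg_of_add_eq_zero_left h1
    · intro h
      exact hx0 (congrArg Subtype.val h)
  have h1 := Submodule.finrank_add_finrank_le_of_disjoint hd
  have h2 := Submodule.finrank_add_eq_of_isCompl hC
  have h3 : Module.finrank K (LinearMap.ker B) < Module.finrank K (LinearMap.ker (A + t • B)) := ht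
  omega

theorem finite_setOf_finrank_coadjointStabilizer_lt [FiniteDimensional K L]
    (f g : Module.Dual K L) :
    {t : K | Module.finrank K (coadjointStabilizer K L g) <
      Module.finrank K (coadjointStabilizer K L (f + t • g))}.Finite := by
  have h := finite_setOf_finrank_ker_lt (kirillovForm f) (kirillovForm g)
  have e : ∀ t : K, kirillovForm f + t • kirillovForm g = kirillovForm (f + t • g) := by
    intro t
    ext x y
    simp [kirillovForm_apply]
  refine h.subset fun t ht => ?_
  rw [Set.mem_ofPred_eq, ← ker_kirillovForm, ← ker_kirillovForm, ← e] at ht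
  exact ht

/-- The index is additive on direct sums of Lie algebras. -/
theorem lieIndex_eq_add {M' : Type*} [LieRing M'] [LieAlgebra K M'] [FiniteDimensional K M]
    [FiniteDimensional K M']
    (s : M →ₗ⁅K⁆ L) (s' : M' →ₗ⁅K⁆ L) (comm : ∀ x y, ⁅s x, s' y⁆ = 0)
    (bij : Function.Bijective fun z : M × M' => s z.1 + s' z.2) :
    lieIndex K L = lieIndex K M + lieIndex K M' := by
  have comm' : ∀ x y, ⁅s' y, s x⁆ = 0 := fun x y => by rw [← lie_skew, comm, neg_zero]
  have inj : Function.Injective (s : M →ₗ[K] L) := by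
    intro x y h
    have := @bij.1 (x, 0) (y, 0) (by simpa using h)
    exact congrArg Prod.fst this
  have inj' : Function.Injective (s' : M' →ₗ[K] L) := by
    intro x y h
    have := @bij.1 (0, x) (0, y) (by simpa using h)
    exact congrArg Prod.snd this
  have key : ∀ f : Module.Dual K L, Module.finrank K (coadjointStabilizer K L f) =
      Module.finrank K (coadjointStabilizer K M (f ∘ₗ (s : M →ₗ[K] L))) +
      Module.finrank K (coadjointStabilizer K M' (f ∘ₗ (s' : M' →ₗ[K] L))) := by
    intro f
    set T := coadjointStabilizer K M (f ∘ₗ (s : M →ₗ[K] L))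
    set T' := coadjointStabilizer K M' (f ∘ₗ (s' : M' →ₗ[K] L))
    have hsup : coadjointStabilizer K L f =
        T.map (s : M →ₗ[K] L) ⊔ T'.map (s' : M' →ₗ[K] L) := by
      apply le_antisymm
      · intro x hx
        obtain ⟨⟨a, b⟩, rfl⟩ := bij.2 x
        refine Submodule.add_mem_sup ⟨a, ?_, rfl⟩ ⟨b, ?_, rfl⟩
        · intro y
          have h1 := hx (s y)
          rw [add_lie, comm', add_zero, ← LieHom.map_lie] at h1
          exact h1
        · intro y
          have h1 := hx (s' y)
          rw [add_lie, comm, zero_add, ← LieHom.map_lie] at h1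
          exact h1
      · refine sup_le ?_ ?_
        · rintro _ ⟨a, ha, rfl⟩ y
          obtain ⟨⟨c, d⟩, rfl⟩ := bij.2 y
          change f ⁅s a, s c + s' d⁆ = 0
          rw [lie_add, comm, add_zero, ← LieHom.map_lie]
          exact ha c
        · rintro _ ⟨a, ha, rfl⟩ y
          obtain ⟨⟨c, d⟩, rfl⟩ := bij.2 y
          change f ⁅s' a, s c + s' d⁆ = 0
          rw [lie_add, comm', zero_add, ← LieHom.map_lie]
          exact ha d
    have hinf : T.map (s : M →ₗ[K] L) ⊓ T'.map (s' : M' →ₗ[K] L) = ⊥ := by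
      rw [eq_bot_iff]
      rintro x ⟨⟨a, -, rfl⟩, ⟨b, -, hb⟩⟩
      have hb' : s' b = s a := hb
      have := @bij.1 (a, 0) (0, b) (by simp [hb'])
      have ha : a = 0 := congrArg Prod.fst this
      simp [ha]
    have e1 := Submodule.finrank_sup_add_finrank_inf_eq (T.map (s : M →ₗ[K] L))
      (T'.map (s' : M' →ₗ[K] L))
    rw [hinf, finrank_bot, ← hsup, ← (Submodule.equivMapOfInjective _ inj T).finrank_eq,
      ← (Submodule.equivMapOfInjective _ inj' T').finrank_eq] at e1
    omega
  apply le_antisymm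
  · obtain ⟨g, hg⟩ := exists_finrank_coadjointStabilizer_eq_lieIndex K M
    obtain ⟨g', hg'⟩ := exists_finrank_coadjointStabilizer_eq_lieIndex K M'
    let e : (M × M') ≃ₗ[K] L := LinearEquiv.ofBijective
      ((s : M →ₗ[K] L).coprod (s' : M' →ₗ[K] L)) bij
    have he : ∀ z, e.symm (s z.1 + s' z.2) = z := fun z => e.symm_apply_apply z
    let f : Module.Dual K L := g.coprod g' ∘ₗ (e.symm : L →ₗ[K] M × M')
    have h1 : f ∘ₗ (s : M →ₗ[K] L) = g := by
      ext x
      have := he (x, 0)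
      simp only [map_zero, add_zero] at this
      simp [f, this]
    have h2 : f ∘ₗ (s' : M' →ₗ[K] L) = g' := by
      ext x
      have := he (0, x)
      simp only [map_zero, zero_add] at this
      simp [f, this]
    rw [← hg, ← hg']
    refine (lieIndex_le f).trans_eq ?_
    rw [key, h1, h2]
  · obtain ⟨f, hf⟩ := exists_finrank_coadjointStabilizer_eq_lieIndex K L
    rw [← hf, key]
    exact add_le_add (lieIndex_le _) (lieIndex_le _)

end IndexGeneral

/-! ### Incidence algebras of preorders and their trace forms. -/

section Incidence

variable (K : Type*) [Field K] {ι : Type*} [Fintype ι] [DecidableEq ι]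

/-- The incidence algebra of a preorder `R`: the matrices supported on `R`. -/
def incidence (R : ι → ι → Prop) [IsPreorder ι R] : Subalgebra K (Matrix ι ι K) where
  carrier := {M | ∀ i j, M i j ≠ 0 → R i j}
  mul_mem' := by
    intro A B hA hB i j hij
    rw [Matrix.mul_apply] at hij
    obtain ⟨k, -, hk⟩ := Finset.exists_ne_zero_of_sum_ne_zero hij
    exact _root_.trans (hA i k (left_ne_zero_of_mul hk)) (hB k j (right_ne_zero_of_mul hk))
  add_mem' := by
    intro A B hA hB i j hij
    by_cases h : A i j = 0
    · refine hB i j fun h' => hij (by simp [h, h'])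
    · exact hA i j h
  algebraMap_mem' := by
    intro r i j hij
    have e : i = j := by
      by_contra h
      exact hij (by simp [Matrix.algebraMap_matrix_apply, h])
    exact e ▸ refl i

variable {K}
variable {R : ι → ι → Prop} [IsPreorder ι R]

theorem incidence_apply_eq_zero (x : incidence K R) {i j : ι} (h : ¬ R i j) : x.1 i j = 0 := by
  by_contra h'
  exact h (x.2 i j h')

theorem single_mem_incidence {i j : ι} (h : R i j) (c : K) :
    Matrix.single i j c ∈ incidence K R := by
  intro a b hab
  by_contra h'
  refine hab (Matrix.single_apply_of_ne _ _ _ _ _ ?_)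
  rintro ⟨rfl, rfl⟩
  exact h' h

variable (R) in
/-- The linear form `x ↦ trace (B * x)` on the incidence algebra. -/
def traceForm (B : Matrix ι ι K) : Module.Dual K (incidence K R) where
  toFun x := Matrix.trace (B * x.1)
  map_add' x y := by simp [mul_add]
  map_smul' c x := by simp

theorem traceForm_apply (B : Matrix ι ι K) (x : incidence K R) :
    traceForm R B x = Matrix.trace (B * x.1) := rfl

theorem traceForm_add_smul (B C : Matrix ι ι K) (t : K) :
    traceForm R (B + t • C) = traceForm R B + t • traceForm R C := by
  ext x
  simp [traceForm_apply, add_mul]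

/-- Any extension of the form to all matrices supplies a representing matrix. It is not unique: only
the entries `B j i` with `R i j` matter. -/
theorem traceForm_surjective : Function.Surjective (traceForm (K := K) R) := by
  intro f
  obtain ⟨g, hg⟩ := LinearMap.exists_extend (p := Subalgebra.toSubmodule (incidence K R)) f
  refine ⟨Matrix.of fun j i => g (Matrix.single i j 1), ?_⟩
  ext x
  have h1 : f x = g x.1 := (LinearMap.congr_fun hg x).symm
  rw [h1, traceForm_apply]
  conv_rhs => rw [Matrix.matrix_eq_sum_single x.1]
  rw [Matrix.trace]
  simp only [Matrix.diag_apply, Matrix.mul_apply, Matrix.of_apply, map_sum]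
  rw [Finset.sum_comm]
  refine Finset.sum_congr rfl fun i _ => Finset.sum_congr rfl fun j _ => ?_
  rw [mul_comm, ← smul_eq_mul, ← map_smul, Matrix.smul_single, smul_eq_mul, mul_one]

theorem coe_lie (x y : incidence K R) :
    (⁅x, y⁆ : incidence K R).1 = x.1 * y.1 - y.1 * x.1 := rfl

theorem traceForm_lie (B : Matrix ι ι K) (x y : incidence K R) :
    traceForm R B ⁅x, y⁆ = Matrix.trace ((B * x.1 - x.1 * B) * y.1) := by
  rw [traceForm_apply, coe_lie, mul_sub, sub_mul, Matrix.trace_sub, Matrix.trace_sub,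
    ← mul_assoc, ← mul_assoc, Matrix.trace_mul_cycle B y.1 x.1]

/-- Testing against matrix units turns orthogonality conditions into the vanishing of single entries
of the commutator of `B` and `x`. -/
theorem traceForm_lie_single (B : Matrix ι ι K) (x : incidence K R) {i j : ι} (h : R i j) :
    traceForm R B ⁅x, (⟨Matrix.single i j 1, single_mem_incidence h 1⟩ : incidence K R)⁆ =
      (B * x.1 - x.1 * B) j i := by
  rw [traceForm_lie, Matrix.trace_mul_single]
  simp

/-- Left multiplication by `u` is injective on a finite-dimensional algebra, hence surjective, so
the inverse is again supported on `R`. -/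
theorem exists_incidence_inv (u : incidence K R) (hu : u.1.det ≠ 0) :
    ∃ w : incidence K R, u.1 * w.1 = 1 ∧ w.1 * u.1 = 1 := by
  have hinj : Function.Injective (LinearMap.mulLeft K u) := by
    rw [← LinearMap.ker_eq_bot, LinearMap.ker_eq_bot']
    intro x hx
    have h1 : u.1 * x.1 = 0 := congrArg Subtype.val hx
    apply Subtype.ext
    have h2 := congrArg (fun m => u.1⁻¹ * m) h1
    simpa [Matrix.nonsing_inv_mul_cancel_left _ _ (isUnit_iff_ne_zero.mpr hu)] using h2
  obtain ⟨w, hw⟩ := (LinearMap.injective_iff_surjective.mp hinj) 1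
  have h1 : u.1 * w.1 = 1 := congrArg Subtype.val hw
  exact ⟨w, h1, mul_eq_one_comm.mp h1⟩

/-- The inner automorphism `x ↦ u x w` pulls the trace form of `B` back to that of `w B u`. -/
theorem finrank_coadjointStabilizer_conj (B : Matrix ι ι K) (u w : incidence K R)
    (huw : u.1 * w.1 = 1) (hwu : w.1 * u.1 = 1) :
    Module.finrank K (coadjointStabilizer K (incidence K R) (traceForm R (w.1 * B * u.1))) =
      Module.finrank K (coadjointStabilizer K (incidence K R) (traceForm R B)) := by
  have huw' : u * w = 1 := Subtype.ext huw
  have hwu' : w * u = 1 := Subtype.ext hwu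
  let e : incidence K R ≃ₗ⁅K⁆ incidence K R :=
    { toFun := fun x => u * x * w
      map_add' := fun x y => by rw [mul_add, add_mul]
      map_smul' := fun c x => by simp
      map_lie' := by
        intro x y
        have h : ∀ a b : incidence K R, u * a * w * (u * b * w) = u * (a * b) * w := by
          intro a b
          calc u * a * w * (u * b * w) = u * a * (w * u) * b * w := by noncomm_ring
            _ = _ := by rw [hwu']; noncomm_ring
        change u * (x * y - y * x) * w = u * x * w * (u * y * w) - u * y * w * (u * x * w)
        rw [h, h, mul_sub, sub_mul]
      invFun := fun x => w * x * u
      left_inv := fun x => by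
        change w * (u * x * w) * u = x
        calc w * (u * x * w) * u = (w * u) * x * (w * u) := by noncomm_ring
          _ = x := by rw [hwu']; simp
      right_inv := fun x => by
        change u * (w * x * u) * w = x
        calc u * (w * x * u) * w = (u * w) * x * (u * w) := by noncomm_ring
          _ = x := by rw [huw']; simp }
  have h : traceForm R (w.1 * B * u.1) =
      traceForm R B ∘ₗ ((e : incidence K R →ₗ⁅K⁆ incidence K R) :
        incidence K R →ₗ[K] incidence K R) := by
    ext x
    change Matrix.trace (w.1 * B * u.1 * x.1) = Matrix.trace (B * (u.1 * x.1 * w.1))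
    rw [← mul_assoc, Matrix.trace_mul_comm _ w.1]
    simp only [mul_assoc]
  rw [h]
  exact finrank_coadjointStabilizer_comp_equiv e (traceForm R B)

theorem finite_setOf_det_map_eval_eq_zero (P : Matrix ι ι (Polynomial K))
    (h : (P.map (Polynomial.eval 0)).det ≠ 0) :
    {t : K | (P.map (Polynomial.eval t)).det = 0}.Finite := by
  have e : ∀ t : K, (P.map (Polynomial.eval t)).det = P.det.eval t := fun t =>
    ((Polynomial.evalRingHom t).map_det P).symm
  have hP : P.det ≠ 0 := by
    intro h0
    rw [e, h0, Polynomial.eval_zero] at h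
    exact h rfl
  simp only [e]
  exact Polynomial.finite_setOfPred_isRoot hP

end Incidence

/-! ### Combinatorial reductions and forms in normal position. -/

section Reduction

variable {K : Type*} [Field K] {ι ι' : Type*}

/-- Combinatorial conditions under which the incidence algebras of `R` and of `R'` have the same
index: the entries of `R` with row outside `I` and column inside `I` span an abelian ideal `V`, the
form on `V` that pairs the nodes with the same image under `p` has an open orbit in the dual of `V`,
and its stabilizer modulo `V` is the incidence algebra of `R'`. -/
structure IsReduction (R : ι → ι → Prop) (R' : ι' → ι' → Prop) (I : ι → Prop) (p : ι → ι') :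
    Prop where
  closed : ∀ i j, R i j → I i → I j
  clique : ∀ i j, I i → I j → R i j
  inj : ∀ i j, (I i ↔ I j) → p i = p j → i = j
  lift : ∀ i j, ¬ I i → ¬ I j → R' (p i) (p j) → R i j
  convex : ∀ i k u, (I i ↔ I k) → R' (p i) u → R' u (p k) → ∃ j, (I j ↔ I i) ∧ p j = u
  surj : ∀ u v, R' u v → ∃ i j, (I i ↔ I j) ∧ p i = u ∧ p j = v
  matched_iff : ∀ i j, ¬ I i → I j → R i j → R' (p j) (p i) →
    ((∃ k, ¬ I k ∧ p k = p j) ↔ ∃ k, I k ∧ p k = p i)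
  descend_out : ∀ i j, ¬ I i → ¬ I j → R i j →
    R' (p i) (p j) ∨ ∃ k, I k ∧ R j k ∧ p k = p i ∧ ∀ l, I l → p l ≠ p j
  descend_in : ∀ i j, I i → I j →
    R' (p i) (p j) ∨ ∃ k, ¬ I k ∧ R k i ∧ p k = p j ∧ ∀ l, ¬ I l → p l = p i → ¬ R l k
  matched_rel : ∀ i j k, ¬ I i → I j → I k → p i = p k → R i j
  matched : ∀ i j, ¬ I i → I j → R i j →
    (∃ k, I k ∧ p k = p i) ∨ ∃ k, ¬ I k ∧ p k = p j ∧ R k i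

theorem sum_ite_unique {ι M : Type*} [Fintype ι] [AddCommMonoid M] {P : ι → Prop}
    [DecidablePred P] {k : ι}
    (g : ι → M) (hk : P k) (h : ∀ l, P l → l = k) : ∑ l, (if P l then g l else 0) = g k := by
  rw [Finset.sum_eq_single k]
  · rw [if_pos hk]
  · intro l _ hl
    rw [if_neg fun h' => hl (h l h')]
  · intro h'
    exact absurd (Finset.mem_univ k) h'

variable [Fintype ι] [DecidableEq ι] [Fintype ι'] [DecidableEq ι']
  {R : ι → ι → Prop} [IsPreorder ι R] {R' : ι' → ι' → Prop} [IsPreorder ι' R']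
  {I : ι → Prop} {p : ι → ι'}

open scoped Classical in
-- `p` is injective on each side of `I`, so a sum over one side reindexes to a sum over `ι'` as soon
-- as the terms that `p` misses vanish. This is what makes `embed` compatible with products.
theorem IsReduction.sum_same_side (h : IsReduction R R' I p) {M : Type*} [AddCommMonoid M]
    (i : ι) (g : ι' → M) (hg : ∀ u, g u ≠ 0 → ∃ j, (I j ↔ I i) ∧ p j = u) :
    ∑ j, (if (I i ↔ I j) then g (p j) else 0) = ∑ u, g u := by
  rw [← Finset.sum_filter]
  have hinj : Set.InjOn p (Finset.univ.filter fun j => (I i ↔ I j) : Finset ι) := by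
    intro a ha b hb hab
    simp only [Finset.coe_filter, Finset.mem_univ, true_and] at ha hb
    exact h.inj a b (ha.symm.trans hb) hab
  rw [← Finset.sum_image (f := g) hinj]
  refine Finset.sum_subset (Finset.subset_univ _) ?_
  intro u _ hu
  by_contra h0
  obtain ⟨j, hj, rfl⟩ := hg u h0
  exact hu (Finset.mem_image_of_mem _ (by simp [hj]))

open scoped Classical in
/-- The embedding of the incidence algebra of `R'` along the two sides of `I`. -/
noncomputable def IsReduction.embed (h : IsReduction R R' I p) :
    incidence K R' →ₗ⁅K⁆ incidence K R where
  toFun y := ⟨Matrix.of fun i j => if (I i ↔ I j) then y.1 (p i) (p j) else 0, by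
    intro i j hij
    simp only [Matrix.of_apply, ne_eq, ite_eq_right_iff, Classical.not_imp] at hij
    by_cases hi : I i
    · exact h.clique i j hi (hij.1.mp hi)
    · exact h.lift i j hi (fun hj => hi (hij.1.mpr hj)) (y.2 _ _ hij.2)⟩
  map_add' x y := by
    ext i j
    by_cases hij : (I i ↔ I j) <;> simp [hij]
  map_smul' c x := by
    ext i j
    by_cases hij : (I i ↔ I j) <;> simp [hij]
  map_lie' := by
    intro x y
    let E : incidence K R' → Matrix ι ι K := fun a =>
      Matrix.of fun i j => if (I i ↔ I j) then a.1 (p i) (p j) else 0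
    have hE : ∀ a i j, E a i j = if (I i ↔ I j) then a.1 (p i) (p j) else 0 := fun _ _ _ => rfl
    -- By `convex`, every intermediate node of a nonzero term of the product has a preimage on the
    -- same side.
    have key : ∀ a b i j, (I i ↔ I j) → (E a * E b) i j = (a.1 * b.1) (p i) (p j) := by
      intro a b i j hij
      rw [Matrix.mul_apply, Matrix.mul_apply,
        ← h.sum_same_side i fun u => a.1 (p i) u * b.1 u (p j)]
      · refine Finset.sum_congr rfl fun k _ => ?_
        rw [hE, hE]
        by_cases hk : (I i ↔ I k)
        · rw [if_pos hk, if_pos hk, if_pos (hk.symm.trans hij)]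
        · rw [if_neg hk, if_neg hk, zero_mul]
      · intro u hu
        exact h.convex i j u hij (a.2 _ _ (left_ne_zero_of_mul hu))
          (b.2 _ _ (right_ne_zero_of_mul hu))
    have key' : ∀ a b i j, ¬ (I i ↔ I j) → (E a * E b) i j = 0 := by
      intro a b i j hij
      rw [Matrix.mul_apply]
      refine Finset.sum_eq_zero fun k _ => ?_
      rw [hE, hE]
      by_cases hk : (I i ↔ I k)
      · rw [if_neg (c := (I k ↔ I j)) fun h' => hij (hk.trans h'), mul_zero]
      · rw [if_neg hk, zero_mul]
    apply Subtype.ext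
    change E ⁅x, y⁆ = E x * E y - E y * E x
    ext i j
    rw [Matrix.sub_apply, hE]
    by_cases hij : (I i ↔ I j)
    · rw [key _ _ _ _ hij, key _ _ _ _ hij, if_pos hij, coe_lie, Matrix.sub_apply]
    · rw [key' _ _ _ _ hij, key' _ _ _ _ hij, if_neg hij, sub_zero]

open scoped Classical in
theorem IsReduction.embed_apply (h : IsReduction R R' I p) (y : incidence K R') (i j : ι) :
    (h.embed y).1 i j = if (I i ↔ I j) then y.1 (p i) (p j) else 0 := rfl

variable (K R I) in
/-- The ideal of the matrices whose nonzero entries have row outside `I` and column inside `I`. -/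
def cornerIdeal : Submodule K (incidence K R) where
  carrier := {v | ∀ i j, v.1 i j ≠ 0 → ¬ I i ∧ I j}
  add_mem' := by
    intro a b ha hb i j hij
    by_cases h : a.1 i j = 0
    · refine hb i j fun h' => hij (by simp [h, h'])
    · exact ha i j h
  zero_mem' := by
    intro i j hij
    exact absurd rfl hij
  smul_mem' := by
    intro c a ha i j hij
    exact ha i j fun h => hij (by simp [h])

theorem mem_cornerIdeal {v : incidence K R} :
    v ∈ cornerIdeal K R I ↔ ∀ i j, v.1 i j ≠ 0 → ¬ I i ∧ I j := Iff.rfl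

theorem IsReduction.eq_zero_of_embed_mem (h : IsReduction R R' I p) (y : incidence K R')
    (hy : h.embed y ∈ cornerIdeal K R I) : y = 0 := by
  refine Subtype.ext (Matrix.ext fun u v => ?_)
  change y.1 u v = 0
  by_contra hne
  obtain ⟨i, j, hij, rfl, rfl⟩ := h.surj u v (y.2 u v hne)
  have h1 : (h.embed y).1 i j ≠ 0 := by
    rw [h.embed_apply, if_pos hij]
    exact hne
  have h2 := mem_cornerIdeal.mp hy i j h1
  exact h2.1 (hij.mpr h2.2)

/-- The linear form pairs the nodes outside `I` with the nodes inside `I` by means of `p`. -/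
def IsNormal (R : ι → ι → Prop) (I : ι → Prop) (p : ι → ι') (B : Matrix ι ι K) : Prop :=
  ∀ i j, ¬ I i → I j → R i j → B j i = if p i = p j then 1 else 0

open scoped Classical in
-- By `closed`, only entries of `B` in the corner enter this entry of the commutator, and there `B`
-- is the 0/1 matching.
theorem IsReduction.commutator_apply (h : IsReduction R R' I p) {B : Matrix ι ι K}
    (hB : IsNormal R I p B) (x : incidence K R) {i j : ι} (hi : ¬ I i) (hj : I j) (hij : R i j) :
    (B * x.1 - x.1 * B) j i = ∑ k, (if ¬ I k ∧ p k = p j then x.1 k i else 0) -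
      ∑ k, (if I k ∧ p k = p i then x.1 j k else 0) := by
  rw [Matrix.sub_apply, Matrix.mul_apply, Matrix.mul_apply]
  congr 1
  · refine Finset.sum_congr rfl fun k _ => ?_
    by_cases hx : x.1 k i = 0
    · simp [hx]
    have hR := x.2 k i hx
    have hk : ¬ I k := fun hk => hi (h.closed k i hR hk)
    rw [hB k j hk hj (_root_.trans hR hij)]
    by_cases hp : p k = p j <;> simp [hk, hp]
  · refine Finset.sum_congr rfl fun k _ => ?_
    by_cases hx : x.1 j k = 0
    · simp [hx]
    have hR := x.2 j k hx
    have hk : I k := h.closed j k hR hj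
    rw [hB i k hi hk (_root_.trans hij hR)]
    by_cases hp : p k = p i
    · simp [hk, hp]
    · simp [hp, Ne.symm hp]

/-- Symplectic reduction along `cornerIdeal`. The field `matched` makes it meet the stabilizer
trivially; `matched_rel`, `descend_out` and `descend_in` show that an element orthogonal to it comes
from `R'` modulo the ideal; `matched_iff` makes the image of `embed` orthogonal to it. -/
theorem IsReduction.finrank_comp_embed (h : IsReduction R R' I p) {B : Matrix ι ι K}
    (hB : IsNormal R I p B) :
    Module.finrank K (coadjointStabilizer K (incidence K R')
      (traceForm R B ∘ₗ ((h.embed : incidence K R' →ₗ⁅K⁆ incidence K R) :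
        incidence K R' →ₗ[K] incidence K R))) =
      Module.finrank K (coadjointStabilizer K (incidence K R) (traceForm R B)) := by
  classical
  have single_mem : ∀ {i j : ι} (hi : ¬ I i) (hj : I j) (hij : R i j),
      (⟨Matrix.single i j 1, single_mem_incidence hij 1⟩ : incidence K R) ∈
        cornerIdeal K R I := by
    intro i j hi hj hij a b hab
    by_contra h'
    refine hab (Matrix.single_apply_of_ne _ _ _ _ _ ?_)
    rintro ⟨rfl, rfl⟩
    exact h' ⟨hi, hj⟩
  have skew : ∀ x y : incidence K R, traceForm R B ⁅x, y⁆ = 0 → traceForm R B ⁅y, x⁆ = 0 := by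
    intro x y hxy
    rw [← lie_skew, map_neg, hxy, neg_zero]
  apply finrank_coadjointStabilizer_comp h.embed (cornerIdeal K R I)
  · intro v hv hv0
    have entry : ∀ a b, R a b → (B * v.1 - v.1 * B) b a = 0 := by
      intro a b hab
      rw [← traceForm_lie_single B v hab]
      exact skew _ _ (hv0 _)
    refine Subtype.ext (Matrix.ext fun i j => ?_)
    change v.1 i j = 0
    by_contra hne
    obtain ⟨hi, hj⟩ := hv i j hne
    have hij := v.2 i j hne
    -- The row `i` or the column `j` has a partner `k`, and a suitable entry of the commutator
    -- isolates `v i j`: through `B * v` in the first case, through `v * B` in the second.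
    rcases h.matched i j hi hj hij with ⟨k, hk, hki⟩ | ⟨k, hk, hkj, hkR⟩
    · have e := entry j k (h.clique j k hj hk)
      have e1 : (v.1 * B) k j = 0 := by
        rw [Matrix.mul_apply]
        refine Finset.sum_eq_zero fun l _ => ?_
        have : v.1 k l = 0 := by
          by_contra h'
          exact (hv k l h').1 hk
        rw [this, zero_mul]
      have e2 : (B * v.1) k j = v.1 i j := by
        rw [Matrix.mul_apply, Finset.sum_eq_single i]
        · rw [hB i k hi hk (_root_.trans hij (h.clique j k hj hk)), if_pos hki.symm, one_mul]
        · intro l _ hl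
          by_cases hvl : v.1 l j = 0
          · rw [hvl, mul_zero]
          have hl' := (hv l j hvl).1
          rw [hB l k hl' hk (_root_.trans (v.2 l j hvl) (h.clique j k hj hk)), if_neg, zero_mul]
          intro h'
          exact hl (h.inj l i (iff_of_false hl' hi) (h'.trans hki))
        · intro h'
          exact absurd (Finset.mem_univ i) h'
      rw [Matrix.sub_apply, e1, e2, sub_zero] at e
      exact hne e
    · have e := entry k i hkR
      have e1 : (B * v.1) i k = 0 := by
        rw [Matrix.mul_apply]
        refine Finset.sum_eq_zero fun l _ => ?_
        have : v.1 l k = 0 := by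
          by_contra h'
          exact hk (hv l k h').2
        rw [this, mul_zero]
      have e2 : (v.1 * B) i k = v.1 i j := by
        rw [Matrix.mul_apply, Finset.sum_eq_single j]
        · rw [hB k j hk hj (_root_.trans hkR hij), if_pos hkj, mul_one]
        · intro l _ hl
          by_cases hvl : v.1 i l = 0
          · rw [hvl, zero_mul]
          have hl' := (hv i l hvl).2
          rw [hB k l hk hl' (_root_.trans hkR (v.2 i l hvl)), if_neg, mul_zero]
          intro h'
          exact hl (h.inj l j (iff_of_true hl' hj) (h'.symm.trans hkj))
        · intro h'
          exact absurd (Finset.mem_univ j) h'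
      rw [Matrix.sub_apply, e1, e2, zero_sub, neg_eq_zero] at e
      exact hne e
  · intro x hx
    have cond : ∀ i j, ¬ I i → I j → R i j → ∑ k, (if ¬ I k ∧ p k = p j then x.1 k i else 0) =
        ∑ k, (if I k ∧ p k = p i then x.1 j k else 0) := by
      intro i j hi hj hij
      rw [← sub_eq_zero, ← h.commutator_apply hB x hi hj hij, ← traceForm_lie_single B x hij]
      exact hx _ (single_mem hi hj hij)
    have sum_out : ∀ {k i u}, ¬ I k → p k = u →
        ∑ l, (if ¬ I l ∧ p l = u then x.1 l i else 0) = x.1 k i := by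
      intro k i u hk hku
      refine sum_ite_unique (P := fun l => ¬ I l ∧ p l = u) (fun l => x.1 l i) ⟨hk, hku⟩ ?_
      rintro l ⟨hl, hlu⟩
      exact h.inj l k (iff_of_false hl hk) (hlu.trans hku.symm)
    have sum_in : ∀ {k j u}, I k → p k = u →
        ∑ l, (if I l ∧ p l = u then x.1 j l else 0) = x.1 j k := by
      intro k j u hk hku
      refine sum_ite_unique (P := fun l => I l ∧ p l = u) (fun l => x.1 j l) ⟨hk, hku⟩ ?_
      rintro l ⟨hl, hlu⟩
      exact h.inj l k (iff_of_true hl hk) (hlu.trans hku.symm)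
    -- Where both sides carry a copy of an entry, orthogonality to the matrix unit at `(j, i')`
    -- forces the copies to agree. Hence `Y` below does not depend on the chosen preimages.
    have consistent : ∀ i j i' j', ¬ I i → ¬ I j → I i' → I j' → p i = p i' → p j = p j' →
        x.1 i j = x.1 i' j' := by
      intro i j i' j' hi hj hi' hj' hii hjj
      have := cond j i' hj hi' (h.matched_rel j i' j' hj hi' hj' hjj)
      rwa [sum_out hi hii, sum_in hj' hjj.symm] at this
    let Y : Matrix ι' ι' K := Matrix.of fun u v =>
      if hh : ∃ i j, (I i ↔ I j) ∧ p i = u ∧ p j = v then x.1 hh.choose hh.choose_spec.choose else 0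
    have hY : ∀ i j, (I i ↔ I j) → Y (p i) (p j) = x.1 i j := by
      intro i j hij
      have hh : ∃ a b, (I a ↔ I b) ∧ p a = p i ∧ p b = p j := ⟨i, j, hij, rfl, rfl⟩
      have e : Y (p i) (p j) = x.1 hh.choose hh.choose_spec.choose := dif_pos hh
      rw [e]
      obtain ⟨hab, ha, hb⟩ := hh.choose_spec.choose_spec
      generalize hh.choose_spec.choose = b at *
      generalize hh.choose = a at *
      by_cases hi : I i <;> by_cases hI : I a
      · rw [h.inj a i (iff_of_true hI hi) ha,
          h.inj b j (iff_of_true (hab.mp hI) (hij.mp hi)) hb]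
      · exact consistent a b i j hI (fun hb => hI (hab.mpr hb)) hi (hij.mp hi) ha hb
      · exact (consistent i j a b hi (fun hb => hi (hij.mpr hb)) hI (hab.mp hI)
          ha.symm hb.symm).symm
      · rw [h.inj a i (iff_of_false hI hi) ha,
          h.inj b j (iff_of_false (fun hb => hI (hab.mpr hb)) (fun hb => hi (hij.mpr hb))) hb]
    -- An entry outside `R'` is one side of an orthogonality condition whose other side is zero,
    -- because a partner or a relation is missing.
    have hYmem : Y ∈ incidence K R' := by
      intro u v huv
      by_cases hh : ∃ i j, (I i ↔ I j) ∧ p i = u ∧ p j = v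
      · obtain ⟨i, j, hij, rfl, rfl⟩ := hh
        rw [hY i j hij] at huv
        by_cases hi : I i
        · rcases h.descend_in i j hi (hij.mp hi) with h' | ⟨k, hk, hkR, hkp, hl⟩
          · exact h'
          · exfalso
            apply huv
            have := cond k i hk hi hkR
            rw [sum_in (hij.mp hi) hkp.symm] at this
            rw [← this]
            refine Finset.sum_eq_zero fun l _ => ?_
            split_ifs with h1
            · exact incidence_apply_eq_zero x (hl l h1.1 h1.2)
            · rfl
        · have hj : ¬ I j := fun hj => hi (hij.mpr hj)
          rcases h.descend_out i j hi hj (x.2 i j huv) with h' | ⟨k, hk, hkR, hkp, hl⟩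
          · exact h'
          · exfalso
            apply huv
            have := cond j k hj hk hkR
            rw [sum_out hi hkp.symm] at this
            rw [this]
            refine Finset.sum_eq_zero fun l _ => if_neg ?_
            rintro ⟨h1, h2⟩
            exact hl l h1 h2
      · exact absurd (dif_neg hh) huv
    refine ⟨x - h.embed ⟨Y, hYmem⟩, ?_, ⟨Y, hYmem⟩, by simp⟩
    intro i j hij
    have e : (x - h.embed ⟨Y, hYmem⟩ : incidence K R).1 i j =
        x.1 i j - (h.embed ⟨Y, hYmem⟩).1 i j := rfl
    rw [e, h.embed_apply] at hij
    by_cases hs : (I i ↔ I j)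
    · rw [if_pos hs] at hij
      exact absurd (sub_eq_zero.mpr (hY i j hs).symm) hij
    · rw [if_neg hs, sub_zero] at hij
      have hc := h.closed i j (x.2 i j hij)
      tauto
  · intro y v hv
    -- Each of the two sums has at most one term, with the same value `y (p j) (p i)`; `matched_iff`
    -- says that they are nonempty together when this value is nonzero.
    have hcomm : ∀ i j, ¬ I i → I j → R i j →
        (B * (h.embed y).1 - (h.embed y).1 * B) j i = 0 := by
      intro i j hi hj hij
      rw [h.commutator_apply hB _ hi hj hij, sub_eq_zero]
      have e1 : ∀ k, (if ¬ I k ∧ p k = p j then (h.embed y).1 k i else 0) =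
          if ¬ I k ∧ p k = p j then y.1 (p j) (p i) else 0 := by
        intro k
        by_cases hk : ¬ I k ∧ p k = p j
        · rw [if_pos hk, if_pos hk, h.embed_apply, if_pos (iff_of_false hk.1 hi), hk.2]
        · rw [if_neg hk, if_neg hk]
      have e2 : ∀ k, (if I k ∧ p k = p i then (h.embed y).1 j k else 0) =
          if I k ∧ p k = p i then y.1 (p j) (p i) else 0 := by
        intro k
        by_cases hk : I k ∧ p k = p i
        · rw [if_pos hk, if_pos hk, h.embed_apply, if_pos (iff_of_true hj hk.1), hk.2]
        · rw [if_neg hk, if_neg hk]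
      simp only [e1, e2]
      by_cases hy : y.1 (p j) (p i) = 0
      · simp [hy]
      have hm := h.matched_iff i j hi hj hij (y.2 _ _ hy)
      by_cases hex : ∃ k, ¬ I k ∧ p k = p j
      · obtain ⟨k', hk'⟩ := hm.mp hex
        obtain ⟨k, hk⟩ := hex
        rw [sum_ite_unique (P := fun k => ¬ I k ∧ p k = p j) (fun _ => y.1 (p j) (p i)) hk fun l hl =>
            h.inj l k (iff_of_false hl.1 hk.1) (hl.2.trans hk.2.symm),
          sum_ite_unique (P := fun k => I k ∧ p k = p i) (fun _ => y.1 (p j) (p i)) hk' fun l hl =>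
            h.inj l k' (iff_of_true hl.1 hk'.1) (hl.2.trans hk'.2.symm)]
      · have hex' : ¬ ∃ k, I k ∧ p k = p i := fun h' => hex (hm.mpr h')
        rw [Finset.sum_eq_zero fun k _ => if_neg fun h' => hex ⟨k, h'⟩,
          Finset.sum_eq_zero fun k _ => if_neg fun h' => hex' ⟨k, h'⟩]
    rw [traceForm_lie, Matrix.trace]
    refine Finset.sum_eq_zero fun j _ => ?_
    rw [Matrix.diag_apply, Matrix.mul_apply]
    refine Finset.sum_eq_zero fun i _ => ?_
    by_cases hvij : v.1 i j = 0
    · rw [hvij, mul_zero]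
    · obtain ⟨hi, hj⟩ := hv i j hvij
      rw [hcomm i j hi hj (v.2 i j hvij), zero_mul]
  · exact h.eq_zero_of_embed_mem

end Reduction

/-! ### Generic forms can be brought to normal position. -/

section ReductionIndex

variable {K : Type*} [Field K] {ι ι' : Type*}
variable [Fintype ι] [DecidableEq ι] [Fintype ι'] [DecidableEq ι']
  {R : ι → ι → Prop} [IsPreorder ι R] {R' : ι' → ι' → Prop} [IsPreorder ι' R']
  {I : ι → Prop} {p : ι → ι'}

open scoped Classical in
/-- The matrix whose columns at the nodes of `I` that have a partner outside `I` are the columns of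
`B` at their partners, cut off outside `I`. -/
noncomputable def matchedColumns (I : ι → Prop) (p : ι → ι') (B : Matrix ι ι K) : Matrix ι ι K :=
  Matrix.of fun j k => if I j ∧ I k then ∑ l, if ¬ I l ∧ p l = p k then B j l else 0 else 0

open scoped Classical in
/-- The coordinate projection away from the nodes of `I` that have a partner outside `I`. -/
noncomputable def unmatchedProj (K : Type*) [Field K] (I : ι → Prop) (p : ι → ι') :
    Matrix ι ι K :=
  Matrix.diagonal fun k => if I k ∧ ∃ l, ¬ I l ∧ p l = p k then 0 else 1

theorem matchedColumns_add_smul (B C : Matrix ι ι K) (t : K) :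
    matchedColumns I p (B + t • C) = matchedColumns I p B + t • matchedColumns I p C := by
  classical
  ext j k
  simp only [matchedColumns, Matrix.of_apply, Matrix.add_apply, Matrix.smul_apply, smul_eq_mul]
  by_cases hjk : I j ∧ I k
  · simp only [if_pos hjk, Finset.mul_sum, ← Finset.sum_add_distrib]
    refine Finset.sum_congr rfl fun l _ => ?_
    split_ifs <;> simp
  · simp [hjk]

theorem IsReduction.matchedColumns_apply (h : IsReduction R R' I p) (B : Matrix ι ι K) {j k l : ι}
    (hj : I j) (hk : I k) (hl : ¬ I l) (hlk : p l = p k) : matchedColumns I p B j k = B j l := by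
  classical
  rw [matchedColumns, Matrix.of_apply, if_pos ⟨hj, hk⟩]
  exact sum_ite_unique (P := fun l => ¬ I l ∧ p l = p k) (fun l => B j l) ⟨hl, hlk⟩ fun m hm =>
    h.inj m l (iff_of_false hm.1 hl) (hm.2.trans hlk.symm)

theorem matchedColumns_eq_zero (B : Matrix ι ι K) {j k : ι} (hjk : ¬ (I j ∧ I k)) :
    matchedColumns I p B j k = 0 := if_neg hjk

theorem matchedColumns_eq_zero_of_unmatched (B : Matrix ι ι K) {j k : ι}
    (hk : ¬ ∃ l, ¬ I l ∧ p l = p k) : matchedColumns I p B j k = 0 := by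
  classical
  rw [matchedColumns, Matrix.of_apply]
  split_ifs
  · exact Finset.sum_eq_zero fun l _ => if_neg fun h' => hk ⟨l, h'⟩
  · rfl

open scoped Classical in
theorem unmatchedProj_apply_self_of_unmatched {k : ι} (hk : ¬ (I k ∧ ∃ l, ¬ I l ∧ p l = p k)) :
    unmatchedProj K I p k k = 1 := by
  rw [unmatchedProj, Matrix.diagonal_apply_eq, if_neg hk]

theorem unmatchedProj_apply_of_ne {j k : ι} (hjk : j ≠ k) : unmatchedProj K I p j k = 0 :=
  Matrix.diagonal_apply_ne _ hjk

theorem unmatchedProj_apply_of_matched {j k : ι} (hk : I k ∧ ∃ l, ¬ I l ∧ p l = p k) :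
    unmatchedProj K I p j k = 0 := by
  classical
  by_cases hjk : j = k
  · subst hjk
    rw [unmatchedProj, Matrix.diagonal_apply_eq, if_pos hk]
  · exact unmatchedProj_apply_of_ne hjk

/-- Along a line through a standard form, the determinant of this matrix is therefore a polynomial
in the parameter that is nonzero at 0. -/
theorem IsReduction.unmatchedProj_add_matchedColumns_standard (h : IsReduction R R' I p)
    {B : Matrix ι ι K} (hB : ∀ i j, ¬ I i → I j → B j i = if p i = p j then 1 else 0) :
    unmatchedProj K I p + matchedColumns I p B = 1 := by
  ext j k
  rw [Matrix.add_apply]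
  by_cases hk : I k ∧ ∃ l, ¬ I l ∧ p l = p k
  · rw [unmatchedProj_apply_of_matched hk, zero_add]
    obtain ⟨hk, l, hl, hlk⟩ := hk
    by_cases hj : I j
    · rw [h.matchedColumns_apply B hj hk hl hlk, hB l j hl hj, Matrix.one_apply]
      by_cases hjk : j = k
      · rw [if_pos hjk, if_pos (hjk ▸ hlk)]
      · rw [if_neg hjk, if_neg fun h' => hjk (h.inj j k (iff_of_true hj hk) (h'.symm.trans hlk))]
    · rw [matchedColumns_eq_zero _ fun h' => hj h'.1, Matrix.one_apply_ne]
      rintro rfl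
      exact hj hk
  · have e : matchedColumns I p B j k = 0 := by
      by_cases hk' : I k
      · exact matchedColumns_eq_zero_of_unmatched _ fun h' => hk ⟨hk', h'⟩
      · exact matchedColumns_eq_zero _ fun h' => hk' h'.2
    rw [e, add_zero]
    by_cases hjk : j = k
    · subst hjk
      rw [unmatchedProj_apply_self_of_unmatched hk, Matrix.one_apply_eq]
    · rw [unmatchedProj_apply_of_ne hjk, Matrix.one_apply_ne hjk]

/-- The conjugating unit is `U = unmatchedProj + matchedColumns`. If `i` outside `I` has the partner
`k` in `I`, the column `i` of `B`, seen on `I`, is the column `k` of `U`, so multiplying by the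
inverse of `U` gives a column of the identity. On the right, `U` does not change columns outside
`I`. -/
theorem IsReduction.exists_matched_normal (h : IsReduction R R' I p) (B : Matrix ι ι K)
    (hdet : (unmatchedProj K I p + matchedColumns I p B).det ≠ 0) :
    ∃ C : Matrix ι ι K, Module.finrank K (coadjointStabilizer K (incidence K R) (traceForm R C)) =
        Module.finrank K (coadjointStabilizer K (incidence K R) (traceForm R B)) ∧
      ∀ i j, ¬ I i → I j → (∃ k, I k ∧ p k = p i) → C j i = if p i = p j then 1 else 0 := by
  have hmem : unmatchedProj K I p + matchedColumns I p B ∈ incidence K R := by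
    intro j k hjk
    by_cases h1 : I j ∧ I k
    · exact h.clique j k h1.1 h1.2
    · rw [Matrix.add_apply, matchedColumns_eq_zero _ h1, add_zero] at hjk
      have : j = k := by
        by_contra hne
        exact hjk (unmatchedProj_apply_of_ne hne)
      exact this ▸ refl j
  obtain ⟨w, huw, hwu⟩ := exists_incidence_inv ⟨_, hmem⟩ hdet
  refine ⟨_, finrank_coadjointStabilizer_conj B ⟨_, hmem⟩ w huw hwu, ?_⟩
  rintro i j hi hj ⟨k, hk, hki⟩
  set U := unmatchedProj K I p + matchedColumns I p B with hU
  have hcol : ∀ a, (w.1 * B * U) a i = (w.1 * B) a i := by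
    intro a
    rw [Matrix.mul_apply, Finset.sum_eq_single i]
    · rw [hU, Matrix.add_apply, unmatchedProj_apply_self_of_unmatched fun h' => hi h'.1,
        matchedColumns_eq_zero _ fun h' => hi h'.2, add_zero, mul_one]
    · intro b _ hb
      rw [hU, Matrix.add_apply, unmatchedProj_apply_of_ne hb,
        matchedColumns_eq_zero _ fun h' => hi h'.2, add_zero, mul_zero]
    · intro h'
      exact absurd (Finset.mem_univ i) h'
  have hrow : (w.1 * B) j i = (w.1 * U) j k := by
    rw [Matrix.mul_apply, Matrix.mul_apply]
    refine Finset.sum_congr rfl fun l _ => ?_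
    by_cases hl : I l
    · rw [hU, Matrix.add_apply, unmatchedProj_apply_of_matched ⟨hk, i, hi, hki.symm⟩, zero_add,
        h.matchedColumns_apply B hl hk hi hki.symm]
    · rw [incidence_apply_eq_zero w fun h' => hl (h.closed j l h' hj), zero_mul, zero_mul]
  have hwu' : w.1 * U = 1 := hwu
  change (w.1 * B * U) j i = _
  rw [hcol, hrow, hwu', Matrix.one_apply]
  by_cases hjk : j = k
  · rw [if_pos hjk, if_pos (hjk ▸ hki.symm)]
  · rw [if_neg hjk, if_neg fun h' => hjk (h.inj j k (iff_of_true hj hk) (h'.symm.trans hki.symm))]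

/-- Column operations clear the remaining columns: from a column `i` outside `I` without partner,
`N` subtracts the matched columns `k` with coefficient `B j i`, where `j` is the partner of `k`. The
field `matched` puts `N` in the algebra. Its nonzero entries have a matched row index and an
unmatched column index, so `N * N = 0`; the left factor `1 + N` leaves the rows in `I` alone. -/
theorem IsReduction.exists_isNormal_of_matched (h : IsReduction R R' I p) (B : Matrix ι ι K)
    (hB : ∀ i j, ¬ I i → I j → (∃ k, I k ∧ p k = p i) → B j i = if p i = p j then 1 else 0) :
    ∃ C : Matrix ι ι K, Module.finrank K (coadjointStabilizer K (incidence K R) (traceForm R C)) =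
        Module.finrank K (coadjointStabilizer K (incidence K R) (traceForm R B)) ∧
      IsNormal R I p C := by
  classical
  let N : Matrix ι ι K := Matrix.of fun k i =>
    if (¬ I k ∧ ¬ I i ∧ ¬ ∃ m, I m ∧ p m = p i) then
      ∑ j, (if I j ∧ p j = p k then (if R i j then B j i else 0) else 0) else 0
  have hN0 : ∀ k i, ¬ (¬ I k ∧ ¬ I i ∧ ¬ ∃ m, I m ∧ p m = p i) → N k i = 0 := fun k i h' => if_neg h'
  have hN1 : ∀ k i j, ¬ I k → ¬ I i → (¬ ∃ m, I m ∧ p m = p i) → I j → p j = p k →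
      N k i = if R i j then B j i else 0 := by
    intro k i j hk hi hm hj hjk
    have e : N k i = ∑ j, (if I j ∧ p j = p k then (if R i j then B j i else 0) else 0) :=
      if_pos ⟨hk, hi, hm⟩
    rw [e]
    exact sum_ite_unique (P := fun j => I j ∧ p j = p k) (fun j => if R i j then B j i else 0)
      ⟨hj, hjk⟩ fun l hl => h.inj l j (iff_of_true hl.1 hj) (hl.2.trans hjk.symm)
  have hN2 : ∀ k i, (¬ ∃ j, I j ∧ p j = p k) → N k i = 0 := by
    intro k i hk
    by_cases hc : (¬ I k ∧ ¬ I i ∧ ¬ ∃ m, I m ∧ p m = p i)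
    · have e : N k i = ∑ j, (if I j ∧ p j = p k then (if R i j then B j i else 0) else 0) :=
        if_pos hc
      rw [e]
      exact Finset.sum_eq_zero fun j _ => if_neg fun h' => hk ⟨j, h'⟩
    · exact hN0 k i hc
  have hNR : ∀ k i, N k i ≠ 0 → R k i := by
    intro k i hki
    by_cases hc : (¬ I k ∧ ¬ I i ∧ ¬ ∃ m, I m ∧ p m = p i)
    · obtain ⟨hk, hi, hm⟩ := hc
      by_cases hj : ∃ j, I j ∧ p j = p k
      · obtain ⟨j, hj, hjk⟩ := hj
        rw [hN1 k i j hk hi hm hj hjk] at hki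
        have hR : R i j := by
          by_contra h'
          exact hki (if_neg h')
        rcases h.matched i j hi hj hR with h' | ⟨l, hl, hlj, hlR⟩
        · exact absurd h' hm
        · rwa [h.inj k l (iff_of_false hk hl) (hjk.symm.trans hlj.symm)]
      · exact absurd (hN2 k i hj) hki
    · exact absurd (hN0 k i hc) hki
  have hNN : N * N = 0 := by
    ext k i
    rw [Matrix.mul_apply]
    refine Finset.sum_eq_zero fun l _ => ?_
    by_cases hl : ∃ j, I j ∧ p j = p l
    · rw [hN0 k l fun h' => h'.2.2 hl, zero_mul]
    · rw [hN2 l i hl, mul_zero]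
  have hNmem : N ∈ incidence K R := hNR
  have h1 : (1 - N) * (1 + N) = 1 := by
    rw [sub_mul, mul_add, mul_add, hNN]
    simp
  have h2 : (1 + N) * (1 - N) = 1 := by
    rw [add_mul, mul_sub, mul_sub, hNN]
    simp
  refine ⟨_, finrank_coadjointStabilizer_conj B
    ⟨1 - N, Subalgebra.sub_mem _ (Subalgebra.one_mem _) hNmem⟩
    ⟨1 + N, Subalgebra.add_mem _ (Subalgebra.one_mem _) hNmem⟩ h1 h2, ?_⟩
  intro i j hi hj hij
  change ((1 + N) * B * (1 - N)) j i = _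
  have e1 : ∀ a, ((1 + N) * B) j a = B j a := by
    intro a
    rw [add_mul, one_mul, Matrix.add_apply, Matrix.mul_apply, Finset.sum_eq_zero, add_zero]
    intro l _
    rw [hN0 j l fun h' => h'.1 hj, zero_mul]
  rw [Matrix.mul_apply]
  simp only [e1, Matrix.sub_apply, mul_sub, Finset.sum_sub_distrib]
  have e2 : ∑ l, B j l * (1 : Matrix ι ι K) l i = B j i := by
    rw [← Matrix.mul_apply, mul_one]
  rw [e2]
  by_cases hm : ∃ m, I m ∧ p m = p i
  · rw [Finset.sum_eq_zero, sub_zero, hB i j hi hj hm]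
    intro l _
    rw [hN0 l i fun h' => h'.2.2 hm, mul_zero]
  · have hne : p i ≠ p j := fun h' => hm ⟨j, hj, h'.symm⟩
    rw [if_neg hne]
    rcases h.matched i j hi hj hij with h' | ⟨l, hl, hlj, hlR⟩
    · exact absurd h' hm
    rw [Finset.sum_eq_single l]
    · rw [hB l j hl hj ⟨j, hj, hlj.symm⟩, if_pos hlj, one_mul, hN1 l i j hl hi hm hj hlj.symm,
        if_pos hij, sub_self]
    · intro k _ hkl
      by_cases hk : I k
      · rw [hN0 k i fun h' => h'.1 hk, mul_zero]
      by_cases hkm : ∃ m, I m ∧ p m = p k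
      · rw [hB k j hk hj hkm, if_neg, zero_mul]
        intro h'
        exact hkl (h.inj k l (iff_of_false hk hl) (h'.trans hlj.symm))
      · rw [hN2 k i hkm, mul_zero]
    · intro h'
      exact absurd (Finset.mem_univ l) h'

/-- The reduction does not change the index. -/
theorem IsReduction.lieIndex_eq [Infinite K] (h : IsReduction R R' I p) :
    lieIndex K (incidence K R) = lieIndex K (incidence K R') := by
  classical
  let B₀ : Matrix ι ι K := Matrix.of fun j i => if p i = p j then 1 else 0
  have hB₀ : ∀ i j, ¬ I i → I j → B₀ j i = if p i = p j then 1 else 0 := fun _ _ _ _ => rfl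
  apply le_antisymm
  · obtain ⟨g, hg⟩ := exists_finrank_coadjointStabilizer_eq_lieIndex K (incidence K R')
    have hker : LinearMap.ker ((h.embed : incidence K R' →ₗ⁅K⁆ incidence K R) :
        incidence K R' →ₗ[K] incidence K R) = ⊥ := by
      rw [LinearMap.ker_eq_bot']
      intro y hy
      refine h.eq_zero_of_embed_mem y ?_
      have : h.embed y = 0 := hy
      rw [this]
      exact Submodule.zero_mem _
    obtain ⟨r, hr⟩ := LinearMap.exists_leftInverse_of_injective _ hker
    obtain ⟨F, hF⟩ := traceForm_surjective (g ∘ₗ r)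
    -- The image of `embed` sees only entries within one side of `I`, so the others can be
    -- overwritten by the standard matching without changing the restricted form.
    let B : Matrix ι ι K := Matrix.of fun j i => if (I i ↔ I j) then F j i else B₀ j i
    have hBe : ∀ i j, B j i = if (I i ↔ I j) then F j i else B₀ j i := fun _ _ => rfl
    have hB : IsNormal R I p B := by
      intro i j hi hj _
      rw [hBe, if_neg, hB₀ i j hi hj]
      tauto
    have hcomp : traceForm R B ∘ₗ ((h.embed : incidence K R' →ₗ⁅K⁆ incidence K R) :
        incidence K R' →ₗ[K] incidence K R) = g := by
      have e : ∀ y, traceForm R B (h.embed y) = traceForm R F (h.embed y) := by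
        intro y
        rw [traceForm_apply, traceForm_apply, Matrix.trace, Matrix.trace]
        refine Finset.sum_congr rfl fun j _ => ?_
        rw [Matrix.diag_apply, Matrix.diag_apply, Matrix.mul_apply, Matrix.mul_apply]
        refine Finset.sum_congr rfl fun i _ => ?_
        rw [h.embed_apply]
        by_cases hij : (I i ↔ I j)
        · rw [hBe, if_pos hij]
        · rw [if_neg hij, mul_zero, mul_zero]
      ext y
      change traceForm R B (h.embed y) = g y
      rw [e, hF]
      exact congrArg g (LinearMap.congr_fun hr y)
    rw [← hg, ← hcomp, h.finrank_comp_embed hB]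
    exact lieIndex_le _
  · obtain ⟨f, hf⟩ := exists_finrank_coadjointStabilizer_eq_lieIndex K (incidence K R)
    obtain ⟨F, rfl⟩ := traceForm_surjective f
    let P : Matrix ι ι (Polynomial K) := Matrix.of fun j k =>
      Polynomial.C ((1 : Matrix ι ι K) j k) + Polynomial.X *
        Polynomial.C (matchedColumns I p F j k)
    have hP : ∀ t : K, P.map (Polynomial.eval t) =
        unmatchedProj K I p + matchedColumns I p (B₀ + t • F) := by
      intro t
      rw [matchedColumns_add_smul, ← add_assoc,
        h.unmatchedProj_add_matchedColumns_standard hB₀]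
      ext j k
      simp [P, mul_comm t]
    have hfin := finite_setOf_det_map_eval_eq_zero P (by
      rw [hP, zero_smul, add_zero, h.unmatchedProj_add_matchedColumns_standard hB₀, Matrix.det_one]
      exact one_ne_zero)
    obtain ⟨t, ht⟩ := (hfin.union (finite_setOf_finrank_coadjointStabilizer_lt
      (traceForm R B₀) (traceForm R F))).exists_notMem
    have ht1 : (P.map (Polynomial.eval t)).det ≠ 0 := fun h' => ht (Or.inl h')
    have ht2 : Module.finrank K (coadjointStabilizer K (incidence K R)
        (traceForm R B₀ + t • traceForm R F)) ≤
        Module.finrank K (coadjointStabilizer K (incidence K R) (traceForm R F)) :=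
      not_lt.mp fun h' => ht (Or.inr h')
    rw [hP] at ht1
    rw [← traceForm_add_smul, hf] at ht2
    obtain ⟨C, hC, hC'⟩ := h.exists_matched_normal _ ht1
    obtain ⟨D, hD, hD'⟩ := h.exists_isNormal_of_matched C hC'
    rw [← hC, ← hD, ← h.finrank_comp_embed hD'] at ht2
    exact (lieIndex_le _).trans ht2

end ReductionIndex

/-! ### The index of the full matrix algebra, and transposition. -/

section TotalAndSwap

variable {K : Type*} [Field K]

theorem mem_coadjointStabilizer_traceForm_iff {ι : Type*} [Fintype ι] [DecidableEq ι]
    {R : ι → ι → Prop} [IsPreorder ι R] (total : ∀ i j, R i j) (B : Matrix ι ι K)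
    (x : incidence K R) :
    x ∈ coadjointStabilizer K (incidence K R) (traceForm R B) ↔ B * x.1 = x.1 * B := by
  rw [mem_coadjointStabilizer]
  constructor
  · intro h
    ext j i
    rw [← sub_eq_zero, ← Matrix.sub_apply, ← traceForm_lie_single B x (total i j)]
    exact h _
  · intro h y
    rw [traceForm_lie, h, sub_self, zero_mul, Matrix.trace_zero]

/-- The matrix whose columns are `v, B v, B² v, …`. -/
def krylov {A : Type*} [CommRing A] {n : ℕ} (B : Matrix (Fin n) (Fin n) A) (v : Fin n → A) :
    Matrix (Fin n) (Fin n) A :=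
  Matrix.of fun i j => (B ^ (j : ℕ)).mulVec v i

theorem krylov_map {A A' : Type*} [CommRing A] [CommRing A'] (φ : A →+* A') {n : ℕ}
    (B : Matrix (Fin n) (Fin n) A) (v : Fin n → A) :
    (krylov B v).map φ = krylov (B.map φ) (φ ∘ v) := by
  ext i j
  simp only [krylov, Matrix.map_apply, Matrix.of_apply]
  rw [RingHom.map_mulVec]
  congr 1
  exact map_pow φ.mapMatrix B j

variable {n : ℕ} {R : Fin n → Fin n → Prop} [IsPreorder (Fin n) R]

/-- The stabilizer is the centralizer of `B`. A matrix commuting with `B` is determined by its value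
at the cyclic vector `v`, which bounds the dimension by `n`; the first `n` powers of `B` are
independent and attain it. -/
theorem finrank_coadjointStabilizer_of_cyclic (total : ∀ i j, R i j) {B : Matrix (Fin n) (Fin n) K}
    {v : Fin n → K} (h : (krylov B v).det ≠ 0) :
    Module.finrank K (coadjointStabilizer K (incidence K R) (traceForm R B)) = n := by
  apply le_antisymm
  · let φ : coadjointStabilizer K (incidence K R) (traceForm R B) →ₗ[K] (Fin n → K) :=
      { toFun := fun x => x.1.1.mulVec v
        map_add' := fun x y => Matrix.add_mulVec _ _ _
        map_smul' := fun c x => Matrix.smul_mulVec _ _ _ }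
    have hφ : Function.Injective φ := by
      rw [← LinearMap.ker_eq_bot, LinearMap.ker_eq_bot']
      intro x hx
      have hx0 : x.1.1.mulVec v = 0 := hx
      have hcomm : Commute x.1.1 B :=
        ((mem_coadjointStabilizer_traceForm_iff total B x.1).mp x.2).symm
      have hzero : x.1.1 * krylov B v = 0 := by
        ext i j
        have e : (x.1.1 * krylov B v) i j = (x.1.1.mulVec ((B ^ (j : ℕ)).mulVec v)) i := rfl
        rw [e, Matrix.mulVec_mulVec, (hcomm.pow_right j).eq, ← Matrix.mulVec_mulVec, hx0,
          Matrix.mulVec_zero]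
        rfl
      apply Subtype.ext
      apply Subtype.ext
      have := congrArg (fun m => m * (krylov B v)⁻¹) hzero
      simpa [Matrix.mul_nonsing_inv_cancel_right _ _ (isUnit_iff_ne_zero.mpr h)] using this
    simpa using LinearMap.finrank_le_finrank_of_injective hφ
  · let b : incidence K R := ⟨B, fun i j _ => total i j⟩
    have hmem : ∀ c, Fintype.linearCombination K (fun j : Fin n => b ^ (j : ℕ)) c ∈
        coadjointStabilizer K (incidence K R) (traceForm R B) := by
      intro c
      rw [Fintype.linearCombination_apply]
      refine Submodule.sum_mem _ fun j _ => Submodule.smul_mem _ _ ?_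
      rw [mem_coadjointStabilizer_traceForm_iff total]
      exact (Commute.refl B).pow_right j
    have hinj : Function.Injective (LinearMap.codRestrict _ _ hmem) := by
      rw [← LinearMap.ker_eq_bot, LinearMap.ker_eq_bot']
      intro c hc
      have h0 : Fintype.linearCombination K (fun j : Fin n => b ^ (j : ℕ)) c = 0 :=
        congrArg Subtype.val hc
      rw [Fintype.linearCombination_apply] at h0
      have h1 : ∑ j : Fin n, c j • B ^ (j : ℕ) = 0 := by
        have := congrArg (incidence K R).val h0
        rw [map_sum] at this
        simpa using this
      refine Matrix.eq_zero_of_mulVec_eq_zero h ?_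
      have h2 := congrArg (fun M => Matrix.mulVec M v) h1
      simp only [Matrix.zero_mulVec, Matrix.sum_mulVec, Matrix.smul_mulVec] at h2
      rw [← h2]
      ext i
      simp only [Matrix.mulVec, dotProduct, krylov, Matrix.of_apply, Finset.sum_apply,
        Pi.smul_apply, smul_eq_mul]
      exact Finset.sum_congr rfl fun j _ => mul_comm _ _
    simpa using LinearMap.finrank_le_finrank_of_injective hinj

/-- The index of `𝔤𝔩ₙ` is `n`. -/
theorem lieIndex_incidence_of_total [Infinite K] (total : ∀ i j, R i j) :
    lieIndex K (incidence K R) = n := by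
  -- The nilpotent shift has the first basis vector as cyclic vector, and its Krylov matrix is the
  -- identity. For the lower bound, `v` stays cyclic at all but finitely many points of a line `S +
  -- t F`.
  let S : Matrix (Fin n) (Fin n) K := Matrix.of fun i j => if (i : ℕ) = j + 1 then 1 else 0
  let v : Fin n → K := fun i => if (i : ℕ) = 0 then 1 else 0
  have hpow : ∀ j : ℕ, j < n → ∀ i : Fin n,
      (S ^ j).mulVec v i = if (i : ℕ) = j then 1 else 0 := by
    intro j
    induction j with
    | zero =>
      intro _ i
      rw [pow_zero, Matrix.one_mulVec]
    | succ j ih =>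
      intro hj i
      rw [pow_succ', ← Matrix.mulVec_mulVec, Matrix.mulVec, dotProduct,
        Finset.sum_eq_single (⟨j, by omega⟩ : Fin n)]
      · rw [ih (by omega), if_pos rfl, mul_one]
        rfl
      · intro k _ hk
        rw [ih (by omega), if_neg, mul_zero]
        intro h'
        exact hk (Fin.ext h')
      · intro h'
        exact absurd (Finset.mem_univ _) h'
  have hS : krylov S v = 1 := by
    ext i j
    rw [krylov, Matrix.of_apply, hpow j j.2, Matrix.one_apply]
    simp only [Fin.ext_iff]
  apply le_antisymm
  · refine (lieIndex_le (traceForm R S)).trans_eq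
      (finrank_coadjointStabilizer_of_cyclic total (v := v) ?_)
    rw [hS, Matrix.det_one]
    exact one_ne_zero
  · obtain ⟨f, hf⟩ := exists_finrank_coadjointStabilizer_eq_lieIndex K (incidence K R)
    obtain ⟨F, rfl⟩ := traceForm_surjective f
    let P := krylov (S.map Polynomial.C + (Polynomial.X : Polynomial K) • F.map Polynomial.C)
      (Polynomial.C ∘ v)
    have hP : ∀ t : K, P.map (Polynomial.eval t) = krylov (S + t • F) v := by
      intro t
      have := krylov_map (Polynomial.evalRingHom t)
        (S.map Polynomial.C + (Polynomial.X : Polynomial K) • F.map Polynomial.C)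
        (Polynomial.C ∘ v)
      refine this.trans ?_
      congr 1
      · ext i j
        simp [mul_comm t]
      · ext i
        simp
    have hfin := finite_setOf_det_map_eval_eq_zero P (by
      rw [hP, zero_smul, add_zero, hS, Matrix.det_one]
      exact one_ne_zero)
    obtain ⟨t, ht⟩ := (hfin.union (finite_setOf_finrank_coadjointStabilizer_lt
      (traceForm R S) (traceForm R F))).exists_notMem
    have ht1 : (P.map (Polynomial.eval t)).det ≠ 0 := fun h' => ht (Or.inl h')
    have ht2 : Module.finrank K (coadjointStabilizer K (incidence K R)
        (traceForm R S + t • traceForm R F)) ≤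
        Module.finrank K (coadjointStabilizer K (incidence K R) (traceForm R F)) :=
      not_lt.mp fun h' => ht (Or.inr h')
    rw [hP] at ht1
    rwa [← traceForm_add_smul, hf, finrank_coadjointStabilizer_of_cyclic total ht1] at ht2

/-- Passing to the opposite preorder does not change the index. -/
theorem lieIndex_incidence_swap {ι : Type*} [Fintype ι] [DecidableEq ι] {R R' : ι → ι → Prop}
    [IsPreorder ι R] [IsPreorder ι R'] (h : ∀ i j, R i j ↔ R' j i) :
    lieIndex K (incidence K R) = lieIndex K (incidence K R') := by
  -- Transposition reverses products; the sign turns it into a Lie isomorphism.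
  let e : incidence K R ≃ₗ⁅K⁆ incidence K R' :=
    { toFun := fun x => ⟨-x.1.transpose, fun i j hij => (h j i).mp (x.2 j i (by simpa using hij))⟩
      map_add' := fun x y => Subtype.ext (by simp [add_comm])
      map_smul' := fun c x => Subtype.ext (by simp)
      map_lie' := fun {x y} => Subtype.ext (by
        simp [coe_lie, Matrix.transpose_mul])
      invFun := fun x => ⟨-x.1.transpose,
        fun i j hij => (h i j).mpr (x.2 j i (by simpa using hij))⟩
      left_inv := fun x => Subtype.ext (by simp)
      right_inv := fun x => Subtype.ext (by simp) }
  exact lieIndex_congr e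

end TotalAndSwap

/-! ### Meanders as pairs of lists, and the two reductions of their first parts. -/

section Lists

/-- The position of the block that contains the node `i`, for consecutive blocks with sizes `l`. -/
def blockIndex : List ℕ → ℕ → ℕ
  | [], _ => 0
  | a :: l, i => if i < a then 0 else blockIndex l (i - a) + 1

theorem blockIndex_mono (l : List ℕ) : Monotone (blockIndex l) := by
  induction l with
  | nil => exact monotone_const
  | cons a l ih =>
    intro i j hij
    simp only [blockIndex]
    have := @ih (i - a) (j - a) (by omega)
    split_ifs <;> omega

/-- The preorder on `n` nodes whose incidence algebra is the seaweed algebra of `l / m`. -/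
def meanderRel (n : ℕ) (l m : List ℕ) (i j : Fin n) : Prop :=
  (i ≤ j ∧ blockIndex l i = blockIndex l j) ∨ (j ≤ i ∧ blockIndex m i = blockIndex m j)

instance (n : ℕ) (l m : List ℕ) : IsPreorder (Fin n) (meanderRel n l m) where
  refl i := Or.inl ⟨le_rfl, rfl⟩
  trans i j k := by
    rintro (⟨h1, h2⟩ | ⟨h1, h2⟩) (⟨h3, h4⟩ | ⟨h3, h4⟩)
    · exact Or.inl ⟨h1.trans h3, h2.trans h4⟩
    · rcases le_total i k with h | h
      · have e1 := blockIndex_mono l (show (i : ℕ) ≤ k from h)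
        have e2 := blockIndex_mono l (show (k : ℕ) ≤ j from h3)
        exact Or.inl ⟨h, by omega⟩
      · have e1 := blockIndex_mono m (show (k : ℕ) ≤ i from h)
        have e2 := blockIndex_mono m (show (i : ℕ) ≤ j from h1)
        exact Or.inr ⟨h, by omega⟩
    · rcases le_total i k with h | h
      · have e1 := blockIndex_mono l (show (j : ℕ) ≤ i from h1)
        have e2 := blockIndex_mono l (show (i : ℕ) ≤ k from h)
        exact Or.inl ⟨h, by omega⟩
      · have e1 := blockIndex_mono m (show (j : ℕ) ≤ k from h3)
        have e2 := blockIndex_mono m (show (k : ℕ) ≤ i from h)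
        exact Or.inr ⟨h, by omega⟩
    · exact Or.inr ⟨h3.trans h1, h2.trans h4⟩

variable (K : Type*) [Field K]

/-- The index of the seaweed algebra of `l / m` on `n` nodes. -/
noncomputable def listIndex (n : ℕ) (l m : List ℕ) : ℕ :=
  lieIndex K (incidence K (meanderRel n l m))

theorem listIndex_swap (n : ℕ) (l m : List ℕ) : listIndex K n l m = listIndex K n m l :=
  lieIndex_incidence_swap fun i j => by simp only [meanderRel]; grind

/-- The first `a` nodes are matched, in order, with the last `a` nodes of the lower block of size `d
+ 2 * a`. Identifying partners deletes the upper block and cuts the rest of the lower block into `d`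
and `a`. -/
theorem isReduction_of_two_mul_le {a d n : ℕ} (l m : List ℕ) (hn : d + a ≤ n) :
    IsReduction (meanderRel (n + a) (a :: l) ((d + 2 * a) :: m)) (meanderRel n l (d :: a :: m))
      (fun i => (i : ℕ) < a)
      (fun i => ⟨if (i : ℕ) < a then i + d else i - a, by split_ifs <;> omega⟩) where
  closed := by
    rintro ⟨i, hi⟩ ⟨j, hj⟩
    simp only [meanderRel, Fin.le_def, blockIndex]
    grind
  clique := by
    rintro ⟨i, hi⟩ ⟨j, hj⟩
    simp only [meanderRel, Fin.le_def, blockIndex]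
    grind
  inj := by
    rintro ⟨i, hi⟩ ⟨j, hj⟩
    simp only [Fin.mk.injEq]
    split_ifs <;> omega
  lift := by
    rintro ⟨i, hi⟩ ⟨j, hj⟩ (h1 : ¬ i < a) (h2 : ¬ j < a)
    simp only [meanderRel, Fin.le_def, blockIndex, if_neg h1, if_neg h2]
    grind
  convex := by
    rintro ⟨i, hi⟩ ⟨k, hk⟩ ⟨u, hu⟩
    by_cases hia : i < a
    · intro h1 h2 h3
      refine ⟨⟨u - d, by omega⟩, ?_⟩
      simp only [meanderRel, Fin.le_def, blockIndex] at *
      grind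
    · intro h1 h2 h3
      refine ⟨⟨u + a, by omega⟩, ?_⟩
      grind
  surj := by
    rintro ⟨u, hu⟩ ⟨v, hv⟩ h
    refine ⟨⟨u + a, by omega⟩, ⟨v + a, by omega⟩, ?_⟩
    grind
  matched_iff := by
    rintro ⟨i, hi⟩ ⟨j, hj⟩ h1 h2 h3 h4
    have e1 : ∃ k : Fin (n + a), ¬ (k : ℕ) < a ∧
        (if (k : ℕ) < a then (k : ℕ) + d else k - a) = if j < a then j + d else j - a :=
      ⟨⟨j + d + a, by grind⟩, by grind⟩
    have e2 : ∃ k : Fin (n + a), (k : ℕ) < a ∧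
        (if (k : ℕ) < a then (k : ℕ) + d else k - a) = if i < a then i + d else i - a := by
      simp only [meanderRel, Fin.le_def, blockIndex] at *
      exact ⟨⟨i - a - d, by omega⟩, by grind⟩
    simp only [Fin.mk.injEq]
    exact iff_of_true e1 e2
  descend_out := by
    rintro ⟨i, hi⟩ ⟨j, hj⟩ (h1 : ¬ i < a) (h2 : ¬ j < a) h3
    -- These entries lead from the matched last `a` nodes of the lower block back to its unmatched
    -- middle `d` nodes; they are lost when that block is cut.
    by_cases h : d + a ≤ i ∧ i < d + 2 * a ∧ j < d + a
    · refine Or.inr ⟨⟨i - a - d, by omega⟩, ?_⟩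
      simp only [meanderRel, Fin.le_def, blockIndex, Fin.mk.injEq] at *
      grind
    · left
      simp only [meanderRel, Fin.le_def, blockIndex, if_neg h1, if_neg h2] at h3 ⊢
      grind
  descend_in := by
    rintro ⟨i, hi⟩ ⟨j, hj⟩ (h1 : i < a) (h2 : j < a)
    -- An entry above the diagonal inside `I` survives only if the partners of its two nodes lie in
    -- one block of `l`.
    by_cases h : j < i ∨ blockIndex l (i + d) = blockIndex l (j + d)
    · left
      simp only [meanderRel, Fin.le_def, blockIndex, if_pos h1, if_pos h2]
      grind
    · refine Or.inr ⟨⟨j + d + a, by omega⟩, ?_⟩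
      simp only [meanderRel, Fin.le_def, blockIndex, Fin.mk.injEq, if_pos h1, if_pos h2]
      refine ⟨by omega, by grind, by grind, ?_⟩
      rintro ⟨k, hk⟩ (h3 : ¬ k < a) h4
      rw [if_neg h3] at h4
      grind
  matched_rel := by
    rintro ⟨i, hi⟩ ⟨j, hj⟩ ⟨k, hk⟩
    simp only [meanderRel, Fin.le_def, blockIndex, Fin.mk.injEq] at *
    grind
  matched := by
    rintro ⟨i, hi⟩ ⟨j, hj⟩ h1 h2 h3
    by_cases h : d + a ≤ i
    · refine Or.inl ⟨⟨i - a - d, by omega⟩, ?_⟩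
      simp only [meanderRel, Fin.le_def, blockIndex, Fin.mk.injEq] at *
      grind
    · refine Or.inr ⟨⟨j + d + a, by grind⟩, ?_⟩
      simp only [meanderRel, Fin.le_def, blockIndex, Fin.mk.injEq] at *
      grind

/-- Here `I` is the first upper block, and its last `d` nodes are matched, in order, with the `d`
nodes of the lower block that follow it. The first `e` nodes of `I` have no partner. -/
theorem isReduction_of_lt_two_mul {d e n : ℕ} (l m : List ℕ) (hn : d + e ≤ n) :
    IsReduction (meanderRel (n + d) ((d + e) :: l) ((2 * d + e) :: m))
      (meanderRel n (e :: l) ((d + e) :: m))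
      (fun i => (i : ℕ) < d + e)
      (fun i => ⟨if (i : ℕ) < d + e then i else i - d, by split_ifs <;> omega⟩) where
  closed := by
    rintro ⟨i, hi⟩ ⟨j, hj⟩
    simp only [meanderRel, Fin.le_def, blockIndex]
    grind
  clique := by
    rintro ⟨i, hi⟩ ⟨j, hj⟩
    simp only [meanderRel, Fin.le_def, blockIndex]
    grind
  inj := by
    rintro ⟨i, hi⟩ ⟨j, hj⟩
    simp only [Fin.mk.injEq]
    split_ifs <;> omega
  lift := by
    rintro ⟨i, hi⟩ ⟨j, hj⟩ (h1 : ¬ i < d + e) (h2 : ¬ j < d + e)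
    simp only [meanderRel, Fin.le_def, blockIndex, if_neg h1, if_neg h2]
    grind
  convex := by
    rintro ⟨i, hi⟩ ⟨k, hk⟩ ⟨u, hu⟩
    by_cases hia : i < d + e
    · intro h1 h2 h3
      refine ⟨⟨u, by omega⟩, ?_⟩
      simp only [meanderRel, Fin.le_def, blockIndex] at *
      grind
    · intro h1 h2 h3
      refine ⟨⟨u + d, by omega⟩, ?_⟩
      simp only [meanderRel, Fin.le_def, blockIndex] at *
      grind
  surj := by
    rintro ⟨u, hu⟩ ⟨v, hv⟩ h
    by_cases h' : u < d + e ∧ v < d + e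
    · refine ⟨⟨u, by omega⟩, ⟨v, by omega⟩, ?_⟩
      grind
    · refine ⟨⟨u + d, by omega⟩, ⟨v + d, by omega⟩, ?_⟩
      simp only [meanderRel, Fin.le_def, blockIndex, Fin.mk.injEq] at *
      grind
  matched_iff := by
    rintro ⟨i, hi⟩ ⟨j, hj⟩ (h1 : ¬ i < d + e) (h2 : j < d + e) h3 h4
    simp only [meanderRel, Fin.le_def, blockIndex, Fin.mk.injEq, if_neg h1, if_pos h2] at h3 h4 ⊢
    have h5 : e ≤ j := by grind
    have h6 : i < 2 * d + e := by grind
    exact iff_of_true ⟨⟨j + d, by omega⟩, by grind⟩ ⟨⟨i - d, by omega⟩, by grind⟩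
  descend_out := by
    rintro ⟨i, hi⟩ ⟨j, hj⟩ (h1 : ¬ i < d + e) (h2 : ¬ j < d + e) h3
    left
    simp only [meanderRel, Fin.le_def, blockIndex, if_neg h1, if_neg h2] at h3 ⊢
    grind
  descend_in := by
    rintro ⟨i, hi⟩ ⟨j, hj⟩ (h1 : i < d + e) (h2 : j < d + e)
    -- The entries that do not survive lie above the diagonal with `j` matched, and either `i` has
    -- no partner or the partners lie in different blocks of `l`.
    by_cases h : e ≤ j ∧ i < j ∧ (i < e ∨ blockIndex l (i - e) ≠ blockIndex l (j - e))
    · refine Or.inr ⟨⟨j + d, by omega⟩, ?_⟩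
      simp only [meanderRel, Fin.le_def, blockIndex, Fin.mk.injEq, if_pos h1, if_pos h2]
      refine ⟨by omega, by grind, by grind, ?_⟩
      rintro ⟨k, hk⟩ (h3 : ¬ k < d + e) h4
      rw [if_neg h3] at h4
      grind
    · left
      simp only [meanderRel, Fin.le_def, blockIndex, if_pos h1, if_pos h2]
      grind
  matched_rel := by
    rintro ⟨i, hi⟩ ⟨j, hj⟩ ⟨k, hk⟩
    simp only [meanderRel, Fin.le_def, blockIndex, Fin.mk.injEq] at *
    grind
  matched := by
    rintro ⟨i, hi⟩ ⟨j, hj⟩ h1 h2 h3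
    simp only [meanderRel, Fin.le_def, blockIndex, Fin.mk.injEq] at *
    exact Or.inl ⟨⟨i - d, by omega⟩, by grind⟩

end Lists

/-! ### The reduction rules for the index, and scaling of all parts. -/

section Rules

variable (K : Type*) [Field K]

theorem lieIndex_incidence_congr {ι : Type*} [Fintype ι] [DecidableEq ι] {R R' : ι → ι → Prop}
    [IsPreorder ι R] [IsPreorder ι R'] (h : ∀ i j, R i j ↔ R' i j) :
    lieIndex K (incidence K R) = lieIndex K (incidence K R') := by
  obtain rfl : R = R' := funext fun i => funext fun j => propext (h i j)
  rfl

/-- The index is additive on disjoint unions of preorders. -/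
theorem lieIndex_incidence_sum {ι ι₁ ι₂ : Type*} [Fintype ι] [DecidableEq ι] [Fintype ι₁]
    [DecidableEq ι₁] [Fintype ι₂] [DecidableEq ι₂] {R : ι → ι → Prop} [IsPreorder ι R]
    {R₁ : ι₁ → ι₁ → Prop} [IsPreorder ι₁ R₁] {R₂ : ι₂ → ι₂ → Prop} [IsPreorder ι₂ R₂]
    (e : ι₁ ⊕ ι₂ ≃ ι) (h₁ : ∀ i j, R (e (.inl i)) (e (.inl j)) ↔ R₁ i j)
    (h₂ : ∀ i j, R (e (.inr i)) (e (.inr j)) ↔ R₂ i j)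
    (h₁₂ : ∀ i j, ¬ R (e (.inl i)) (e (.inr j))) (h₂₁ : ∀ i j, ¬ R (e (.inr i)) (e (.inl j))) :
    lieIndex K (incidence K R) = lieIndex K (incidence K R₁) + lieIndex K (incidence K R₂) := by
  let D : Matrix ι₁ ι₁ K → Matrix ι₂ ι₂ K → Matrix ι ι K := fun x y =>
    (Matrix.fromBlocks x 0 0 y).submatrix e.symm e.symm
  have hDe : ∀ x y s t, D x y (e s) (e t) = Matrix.fromBlocks x 0 0 y s t := by
    intro x y s t
    simp [D]
  have hadd : ∀ x y x' y', D (x + x') (y + y') = D x y + D x' y' := by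
    intro x y x' y'
    ext i j
    obtain ⟨s, rfl⟩ := e.surjective i
    obtain ⟨t, rfl⟩ := e.surjective j
    rw [Matrix.add_apply, hDe, hDe, hDe]
    rcases s with s | s <;> rcases t with t | t <;> simp
  have hsub : ∀ x y x' y', D (x - x') (y - y') = D x y - D x' y' := by
    intro x y x' y'
    rw [eq_sub_iff_add_eq, ← hadd, sub_add_cancel, sub_add_cancel]
  have hmul : ∀ x y x' y', D (x * x') (y * y') = D x y * D x' y' := by
    intro x y x' y'
    simp only [D]
    rw [Matrix.submatrix_mul_equiv, Matrix.fromBlocks_multiply]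
    simp
  have hsmul : ∀ (c : K) x y, D (c • x) (c • y) = c • D x y := by
    intro c x y
    ext i j
    obtain ⟨s, rfl⟩ := e.surjective i
    obtain ⟨t, rfl⟩ := e.surjective j
    rw [Matrix.smul_apply, hDe, hDe]
    rcases s with s | s <;> rcases t with t | t <;> simp
  have hmem : ∀ (x : incidence K R₁) (y : incidence K R₂), D x.1 y.1 ∈ incidence K R := by
    intro x y i j
    obtain ⟨s, rfl⟩ := e.surjective i
    obtain ⟨t, rfl⟩ := e.surjective j
    rw [hDe]
    rcases s with s | s <;> rcases t with t | t
    · exact fun h => (h₁ s t).mpr (x.2 s t h)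
    · exact fun h => absurd rfl h
    · exact fun h => absurd rfl h
    · exact fun h => (h₂ s t).mpr (y.2 s t h)
  let s : incidence K R₁ →ₗ⁅K⁆ incidence K R :=
    { toFun := fun x => ⟨D x.1 0, hmem x 0⟩
      map_add' := fun x y => Subtype.ext (by
        have := hadd x.1 0 y.1 0
        rwa [add_zero] at this)
      map_smul' := fun c x => Subtype.ext (by
        have := hsmul c x.1 0
        rwa [smul_zero] at this)
      map_lie' := fun {x y} => Subtype.ext (by
        have := hsub (x.1 * y.1) (0 * 0) (y.1 * x.1) (0 * 0)
        rw [hmul, hmul, mul_zero, sub_zero] at this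
        exact this) }
  let s' : incidence K R₂ →ₗ⁅K⁆ incidence K R :=
    { toFun := fun x => ⟨D 0 x.1, hmem 0 x⟩
      map_add' := fun x y => Subtype.ext (by
        have := hadd 0 x.1 0 y.1
        rwa [add_zero] at this)
      map_smul' := fun c x => Subtype.ext (by
        have := hsmul c 0 x.1
        rwa [smul_zero] at this)
      map_lie' := fun {x y} => Subtype.ext (by
        have := hsub (0 * 0) (x.1 * y.1) (0 * 0) (y.1 * x.1)
        rw [hmul, hmul, mul_zero, sub_zero] at this
        exact this) }
  have hss' : ∀ z : incidence K R₁ × incidence K R₂, (s z.1 + s' z.2).1 = D z.1.1 z.2.1 := by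
    intro z
    have := hadd z.1.1 0 0 z.2.1
    rw [add_zero, zero_add] at this
    exact this.symm
  refine lieIndex_eq_add s s' ?_ ⟨?_, ?_⟩
  · intro x y
    apply Subtype.ext
    change D x.1 0 * D 0 y.1 - D 0 y.1 * D x.1 0 = 0
    rw [← hmul, ← hmul, ← hsub]
    simp [D]
  · intro z w hzw
    have h : D z.1.1 z.2.1 = D w.1.1 w.2.1 := by
      rw [← hss', ← hss']
      exact congrArg Subtype.val hzw
    refine Prod.ext (Subtype.ext (Matrix.ext fun i j => ?_)) (Subtype.ext (Matrix.ext fun i j => ?_))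
    · have := congrFun (congrFun h (e (.inl i))) (e (.inl j))
      rwa [hDe, hDe] at this
    · have := congrFun (congrFun h (e (.inr i))) (e (.inr j))
      rwa [hDe, hDe] at this
  · intro x
    refine ⟨⟨⟨Matrix.of fun i j => x.1 (e (.inl i)) (e (.inl j)), fun i j h => (h₁ i j).mp
      (x.2 _ _ h)⟩, ⟨Matrix.of fun i j => x.1 (e (.inr i)) (e (.inr j)), fun i j h => (h₂ i j).mp
      (x.2 _ _ h)⟩⟩, Subtype.ext ?_⟩
    rw [hss']
    ext i j
    obtain ⟨s, rfl⟩ := e.surjective i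
    obtain ⟨t, rfl⟩ := e.surjective j
    rw [hDe]
    rcases s with s | s <;> rcases t with t | t
    · rfl
    · exact (incidence_apply_eq_zero x (h₁₂ s t)).symm
    · exact (incidence_apply_eq_zero x (h₂₁ s t)).symm
    · rfl

theorem listIndex_zero (l m : List ℕ) : listIndex K 0 l m = 0 := by
  refine Nat.le_zero.mp ((lieIndex_le 0).trans ((Submodule.finrank_le _).trans ?_))
  exact (Submodule.finrank_le (Subalgebra.toSubmodule (incidence K (meanderRel 0 l m)))).trans
    (by simp [Module.finrank_matrix])

theorem listIndex_zero_cons (n : ℕ) (l m : List ℕ) :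
    listIndex K n (0 :: l) m = listIndex K n l m :=
  lieIndex_incidence_congr K fun i j => by simp [meanderRel, blockIndex]

variable [Infinite K]

/-- Equal first blocks split off a direct summand gl_a, whose index is `a`. -/
theorem listIndex_cons_self (a n : ℕ) (l m : List ℕ) :
    listIndex K (n + a) (a :: l) (a :: m) = a + listIndex K n l m := by
  let e : Fin a ⊕ Fin n ≃ Fin (n + a) := finSumFinEquiv.trans (finCongr (add_comm a n))
  have h₁ : ∀ i, ((e (.inl i) : Fin (n + a)) : ℕ) = i := fun i => by simp [e]
  have h₂ : ∀ i, ((e (.inr i) : Fin (n + a)) : ℕ) = i + a := fun i => by simp [e, add_comm]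
  have : IsPreorder (Fin a) fun _ _ => True := { refl := by simp, trans := by simp }
  rw [listIndex, lieIndex_incidence_sum K (R₁ := fun _ _ : Fin a => True)
    (R₂ := meanderRel n l m) e, lieIndex_incidence_of_total fun _ _ => trivial, listIndex]
  · intro i j
    simp only [meanderRel, Fin.le_def, h₁, blockIndex]
    have := i.2
    have := j.2
    grind
  · intro i j
    simp only [meanderRel, Fin.le_def, h₂, blockIndex]
    grind
  · intro i j
    simp only [meanderRel, Fin.le_def, h₁, h₂, blockIndex]
    have := i.2
    grind
  · intro i j
    simp only [meanderRel, Fin.le_def, h₁, h₂, blockIndex]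
    have := j.2
    grind

theorem listIndex_of_two_mul_le {a d n : ℕ} (l m : List ℕ) (hn : d + a ≤ n) :
    listIndex K (n + a) (a :: l) ((d + 2 * a) :: m) = listIndex K n l (d :: a :: m) :=
  (isReduction_of_two_mul_le l m hn).lieIndex_eq

theorem listIndex_of_lt_two_mul {d e n : ℕ} (l m : List ℕ) (hn : d + e ≤ n) :
    listIndex K (n + d) ((d + e) :: l) ((2 * d + e) :: m) =
      listIndex K n (e :: l) ((d + e) :: m) :=
  (isReduction_of_lt_two_mul l m hn).lieIndex_eq

/-- Multiplying all parts by `c` multiplies the index by `c`. -/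
theorem listIndex_map_mul (c : ℕ) (n : ℕ) (l m : List ℕ) (hl : l.sum = n) (hm : m.sum = n) :
    listIndex K (c * n) (l.map (c * ·)) (m.map (c * ·)) = c * listIndex K n l m := by
  -- The number of nodes plus the number of parts drops under every rule. The lengths are needed
  -- because the rule for `2 * a ≤ b` can create a part 0, whose removal leaves `n` unchanged.
  obtain ⟨N, hN⟩ : ∃ N, n + l.length + m.length ≤ N := ⟨_, le_rfl⟩
  induction N generalizing n l m with
  | zero =>
    obtain rfl : n = 0 := by omega
    rw [mul_zero, listIndex_zero, listIndex_zero, mul_zero]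
  | succ N ih =>
    have main : ∀ (n a b : ℕ) (l m : List ℕ), (a :: l).sum = n → (b :: m).sum = n →
        n + (a :: l).length + (b :: m).length ≤ N + 1 → a ≤ b →
        listIndex K (c * n) ((a :: l).map (c * ·)) ((b :: m).map (c * ·)) =
          c * listIndex K n (a :: l) (b :: m) := by
      intro n a b l m hl hm hN hab
      simp only [List.sum_cons, List.length_cons] at hl hm hN
      rcases Nat.eq_zero_or_pos a with rfl | ha
      · rw [List.map_cons, mul_zero, listIndex_zero_cons, listIndex_zero_cons]
        refine ih n l (b :: m) (by omega) (by simpa using hm) ?_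
        simp only [List.length_cons]
        omega
      rcases hab.eq_or_lt with rfl | hab
      · obtain ⟨k, rfl⟩ : ∃ k, n = k + a := ⟨n - a, by omega⟩
        rw [List.map_cons, List.map_cons, mul_add, listIndex_cons_self, listIndex_cons_self,
          ih k l m (by omega) (by omega) (by omega), mul_add]
      rcases le_or_gt (2 * a) b with h | h
      · obtain ⟨d, rfl⟩ : ∃ d, b = d + 2 * a := ⟨b - 2 * a, by omega⟩
        obtain ⟨k, rfl⟩ : ∃ k, n = k + a := ⟨n - a, by omega⟩
        have e : c * (d + 2 * a) = c * d + 2 * (c * a) := by ring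
        have hc : c * d + c * a ≤ c * k := by
          rw [← mul_add]
          exact Nat.mul_le_mul_left c (by omega)
        rw [List.map_cons, List.map_cons, mul_add c k a, e, listIndex_of_two_mul_le K _ _ hc,
          listIndex_of_two_mul_le K _ _ (by omega)]
        refine ih k l (d :: a :: m) (by omega) (by simp only [List.sum_cons]; omega) ?_
        simp only [List.length_cons]
        omega
      · obtain ⟨d, rfl⟩ : ∃ d, b = a + d := ⟨b - a, by omega⟩
        obtain ⟨e, rfl⟩ : ∃ e, a = d + e := ⟨a - d, by omega⟩
        obtain ⟨k, rfl⟩ : ∃ k, n = k + d := ⟨n - d, by omega⟩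
        have e1 : d + e + d = 2 * d + e := by ring
        have e2 : c * (2 * d + e) = 2 * (c * d) + c * e := by ring
        have hc : c * d + c * e ≤ c * k := by
          rw [← mul_add]
          exact Nat.mul_le_mul_left c (by omega)
        rw [e1, List.map_cons, List.map_cons, mul_add c k d, e2, mul_add c d e,
          listIndex_of_lt_two_mul K _ _ hc, listIndex_of_lt_two_mul K _ _ (by omega), ← mul_add]
        refine ih k (e :: l) ((d + e) :: m) (by simp only [List.sum_cons]; omega)
          (by simp only [List.sum_cons]; omega) ?_
        simp only [List.length_cons]
        omega
    match l, m with
    | [], _ =>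
      obtain rfl : n = 0 := by simpa using hl.symm
      rw [mul_zero, listIndex_zero, listIndex_zero, mul_zero]
    | _, [] =>
      obtain rfl : n = 0 := by simpa using hm.symm
      rw [mul_zero, listIndex_zero, listIndex_zero, mul_zero]
    | a :: l, b :: m =>
      rcases le_total a b with hab | hab
      · exact main n a b l m hl hm hN hab
      · rw [listIndex_swap, listIndex_swap K n]
        exact main n b a m l hm hl (by omega) hab

end Rules

/-! ### From compositions to lists. -/

section Compositions

theorem blockIndex_eq_of_le_of_lt (l : List ℕ) (i k : ℕ) (h1 : (l.take k).sum ≤ i)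
    (h2 : i < (l.take (k + 1)).sum) : blockIndex l i = k := by
  induction l generalizing i k with
  | nil => simp at h2
  | cons a l ih =>
    cases k with
    | zero =>
      simp only [zero_add, List.take_succ_cons, List.take_zero, List.sum_cons, List.sum_nil,
        add_zero] at h2
      simp [blockIndex, h2]
    | succ k =>
      simp only [List.take_succ_cons, List.sum_cons] at h1 h2
      rw [blockIndex, if_neg (by omega), ih (i - a) k (by omega) (by omega)]

theorem coe_index_eq_blockIndex {n : ℕ} (lam : Composition n) (i : Fin n) :
    (lam.index i : ℕ) = blockIndex lam.blocks i :=
  (blockIndex_eq_of_le_of_lt _ _ _ (lam.sizeUpTo_index_le i)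
    (lam.lt_sizeUpTo_index_succ i)).symm

theorem index_eq_iff {n : ℕ} (lam : Composition n) (i j : Fin n) :
    lam.index i = lam.index j ↔ blockIndex lam.blocks i = blockIndex lam.blocks j := by
  rw [Fin.ext_iff, coe_index_eq_blockIndex, coe_index_eq_blockIndex]

theorem mem_seaweedSubalgebra_iff (K : Type*) [Field K] {n : ℕ} (m : Meander n)
    (M : Matrix (Fin n) (Fin n) K) :
    M ∈ seaweedSubalgebra K m ↔ M ∈ incidence K (meanderRel n m.1.blocks m.2.blocks) := by
  have h : ∀ i j : Fin n, (i < j → m.1.index i = m.1.index j) ∧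
      (j < i → m.2.index i = m.2.index j) ↔ meanderRel n m.1.blocks m.2.blocks i j := by
    intro i j
    rw [index_eq_iff, index_eq_iff, meanderRel]
    rcases lt_trichotomy i j with hij | rfl | hij
    · simp [hij, hij.le, hij.not_gt, hij.not_ge]
    · simp
    · simp [hij, hij.le, hij.not_gt, hij.not_ge]
  exact forall₂_congr fun i j => imp_congr Iff.rfl (h i j)

theorem meanderIndex_eq_listIndex (K : Type*) [Field K] {n : ℕ} (m : Meander n) :
    meanderIndex K m = listIndex K n m.1.blocks m.2.blocks := by
  let e : seaweed K m ≃ₗ⁅K⁆ incidence K (meanderRel n m.1.blocks m.2.blocks) :=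
    { toFun := fun x => ⟨x.1, (mem_seaweedSubalgebra_iff K m x.1).mp x.2⟩
      map_add' := fun _ _ => rfl
      map_smul' := fun _ _ => rfl
      map_lie' := rfl
      invFun := fun x => ⟨x.1, (mem_seaweedSubalgebra_iff K m x.1).mpr x.2⟩
      left_inv := fun _ => rfl
      right_inv := fun _ => rfl }
  exact lieIndex_congr e

end Compositions

/-! ### Lists of parts 1, 3, 4 and their decomposition by the first part. -/

section PartLists

/-- The lists of parts `1`, `3`, `4` with sum `n`. -/
def partLists (n : ℕ) : Finset (List ℕ) :=
  (Finset.univ.image fun lam : Composition n => lam.blocks).filter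
    fun l => ∀ p ∈ l, p = 1 ∨ p = 3 ∨ p = 4

theorem mem_partLists {n : ℕ} {l : List ℕ} :
    l ∈ partLists n ↔ l.sum = n ∧ ∀ p ∈ l, p = 1 ∨ p = 3 ∨ p = 4 := by
  simp only [partLists, Finset.mem_filter, Finset.mem_image, Finset.mem_univ, true_and]
  constructor
  · rintro ⟨⟨lam, rfl⟩, h⟩
    exact ⟨lam.blocks_sum, h⟩
  · rintro ⟨h1, h2⟩
    exact ⟨⟨⟨l, fun {p} hp => by have := h2 p hp; omega, h1⟩, rfl⟩, h2⟩

/-- The lists of parts `1`, `3`, `4` with sum `n - p`; there are none if `n < p`. -/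
def partListsSub (n p : ℕ) : Finset (List ℕ) := if p ≤ n then partLists (n - p) else ∅

theorem mem_partListsSub {n p : ℕ} {l : List ℕ} :
    l ∈ partListsSub n p ↔ p + l.sum = n ∧ ∀ q ∈ l, q = 1 ∨ q = 3 ∨ q = 4 := by
  rw [partListsSub]
  split_ifs with h
  · rw [mem_partLists]
    exact and_congr_left' (by omega)
  · simp only [Finset.notMem_empty, false_iff, not_and]
    intro h'
    omega

theorem partListsSub_zero (n : ℕ) : partListsSub n 0 = partLists n := if_pos n.zero_le

theorem partListsSub_add (n p q : ℕ) : partListsSub (n + p) (p + q) = partListsSub n q := by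
  ext l
  rw [mem_partListsSub, mem_partListsSub]
  exact and_congr_left' (by omega)

theorem partLists_zero : partLists 0 = {[]} := by
  ext l
  rw [mem_partLists, Finset.mem_singleton]
  constructor
  · rintro ⟨h1, h2⟩
    cases l with
    | nil => rfl
    | cons p l =>
      have := h2 p List.mem_cons_self
      simp only [List.sum_cons] at h1
      omega
  · rintro rfl
    simp

theorem sum_partLists {M : Type*} [AddCommMonoid M] {n : ℕ} (hn : 0 < n) (h : List ℕ → M) :
    ∑ l ∈ partLists n, h l = ∑ l ∈ partListsSub n 1, h (1 :: l) +
      ∑ l ∈ partListsSub n 3, h (3 :: l) + ∑ l ∈ partListsSub n 4, h (4 :: l) := by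
  have inj : ∀ p : ℕ, Set.InjOn (List.cons p) (partListsSub n p : Finset (List ℕ)) :=
    fun p a _ b _ hab => List.cons_injective hab
  have hdisj : ∀ p q : ℕ, p ≠ q → ∀ s t : Finset (List ℕ),
      Disjoint (s.image (List.cons p)) (t.image (List.cons q)) := by
    intro p q hpq s t
    rw [Finset.disjoint_left]
    intro l h1 h2
    obtain ⟨a, -, rfl⟩ := Finset.mem_image.mp h1
    obtain ⟨b, -, hb⟩ := Finset.mem_image.mp h2
    exact hpq (List.cons_eq_cons.mp hb).1.symm
  have e : partLists n = (partListsSub n 1).image (List.cons 1) ∪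
      (partListsSub n 3).image (List.cons 3) ∪ (partListsSub n 4).image (List.cons 4) := by
    ext l
    simp only [Finset.mem_union, Finset.mem_image, mem_partListsSub, mem_partLists]
    constructor
    · rintro ⟨h1, h2⟩
      cases l with
      | nil => simp only [List.sum_nil] at h1; omega
      | cons p l =>
        have h3 : ∀ q ∈ l, q = 1 ∨ q = 3 ∨ q = 4 := fun q hq => h2 q (List.mem_cons_of_mem _ hq)
        rw [List.sum_cons] at h1
        rcases h2 p List.mem_cons_self with rfl | rfl | rfl
        · exact Or.inl (Or.inl ⟨l, ⟨h1, h3⟩, rfl⟩)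
        · exact Or.inl (Or.inr ⟨l, ⟨h1, h3⟩, rfl⟩)
        · exact Or.inr ⟨l, ⟨h1, h3⟩, rfl⟩
    · rintro ((⟨l, ⟨h1, h2⟩, rfl⟩ | ⟨l, ⟨h1, h2⟩, rfl⟩) | ⟨l, ⟨h1, h2⟩, rfl⟩) <;>
        simp only [List.sum_cons, List.mem_cons, forall_eq_or_imp] <;>
        exact ⟨h1, by decide, h2⟩
  rw [e, Finset.sum_union, Finset.sum_union (hdisj 1 3 (by decide) _ _),
    Finset.sum_image (inj 1), Finset.sum_image (inj 3), Finset.sum_image (inj 4)]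
  rw [Finset.disjoint_union_left]
  exact ⟨hdisj 1 4 (by decide) _ _, hdisj 3 4 (by decide) _ _⟩

end PartLists

/-! ### The transfer recursion for meanders with a pending prefix. -/

section Counting

variable (K : Type*) [Field K]

/-- The number of pairs `(l, m)` of lists of parts `1`, `3`, `4` such that `m` has sum `n` and
`(s ++ l) / m` is a meander on `n` nodes with index `k`. -/
noncomputable def pendingCount (s : List ℕ) (n k : ℕ) : ℤ :=
  ∑ m ∈ partLists n, ∑ l ∈ partListsSub n s.sum, if listIndex K n (s ++ l) m = k then 1 else 0

/-- The part of `pendingCount` for which the first lower part is `p`. -/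
noncomputable def pendingCountHead (s : List ℕ) (p n k : ℕ) : ℤ :=
  ∑ m ∈ partListsSub n p, ∑ l ∈ partListsSub n s.sum,
    if listIndex K n (s ++ l) (p :: m) = k then 1 else 0

/-- The coefficients of the product of a power series with `x ^ i * y ^ j`. -/
def shift (i j : ℕ) (a : ℕ → ℕ → ℤ) (n k : ℕ) : ℤ :=
  if i ≤ n ∧ j ≤ k then a (n - i) (k - j) else 0

theorem pendingCount_eq_sum_head {s : List ℕ} (hs : 0 < s.sum) (n k : ℕ) :
    pendingCount K s n k = pendingCountHead K s 1 n k + pendingCountHead K s 3 n k +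
      pendingCountHead K s 4 n k := by
  rcases Nat.eq_zero_or_pos n with rfl | hn
  · have e : partListsSub 0 s.sum = ∅ := if_neg (by omega)
    simp [pendingCount, pendingCountHead, e]
  · exact sum_partLists hn _

theorem pendingCount_nil (n k : ℕ) :
    pendingCount K [] n k = (if n = 0 ∧ k = 0 then 1 else 0) + pendingCount K [1] n k +
      pendingCount K [3] n k + pendingCount K [4] n k := by
  simp only [pendingCount, List.sum_nil, List.nil_append, partListsSub_zero, List.sum_singleton,
    List.singleton_append]
  rcases Nat.eq_zero_or_pos n with rfl | hn
  · have e : ∀ p, 0 < p → partListsSub 0 p = ∅ := fun p hp => if_neg (by omega)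
    simp [e, partLists_zero, listIndex_zero, eq_comm]
  · rw [if_neg (by omega), zero_add, ← Finset.sum_add_distrib, ← Finset.sum_add_distrib]
    exact Finset.sum_congr rfl fun m _ => sum_partLists hn _

theorem ite_add_eq (w a k : ℕ) : (if w + a = k then (1 : ℤ) else 0) =
    if w ≤ k then (if a = k - w then 1 else 0) else 0 := by
  split_ifs <;> first | rfl | omega

/-- The case where the lower part `p` is used up: `t` stays pending above, `p` nodes disappear and
the index drops by `w`. -/
theorem pendingCountHead_eq_shift_of_le {s t : List ℕ} {p w : ℕ} (hs : s.sum = p + t.sum)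
    (rule : ∀ n l m, t.sum ≤ n →
      listIndex K (n + p) (s ++ l) (p :: m) = w + listIndex K n (t ++ l) m) (n k : ℕ) :
    pendingCountHead K s p n k = shift p w (pendingCount K t) n k := by
  rw [pendingCountHead, shift]
  by_cases hp : p ≤ n
  · obtain ⟨n, rfl⟩ : ∃ r, n = r + p := ⟨n - p, by omega⟩
    rw [hs, partListsSub_add]
    have e : partListsSub (n + p) p = partLists n := by
      have := partListsSub_add n p 0
      rwa [add_zero, partListsSub_zero] at this
    have e2 : ∀ m, ∑ l ∈ partListsSub n t.sum,
        (if listIndex K (n + p) (s ++ l) (p :: m) = k then (1 : ℤ) else 0) =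
        ∑ l ∈ partListsSub n t.sum,
          if w ≤ k then (if listIndex K n (t ++ l) m = k - w then 1 else 0) else 0 := by
      intro m
      refine Finset.sum_congr rfl fun l hl => ?_
      rw [rule n l m (by have := (mem_partListsSub.mp hl).1; omega), ite_add_eq]
    rw [e, Finset.sum_congr rfl fun m _ => e2 m, pendingCount, Nat.add_sub_cancel]
    by_cases hw : w ≤ k
    · simp [hw]
    · simp [hw]
  · have e : partListsSub n p = ∅ := if_neg hp
    rw [e, Finset.sum_empty, if_neg fun h => hp h.1]

/-- The case where the prefix `s` is used up and `t` stays pending below. Exchanging the two sides,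
which keeps the index, brings it back above. -/
theorem pendingCountHead_eq_shift_of_ge {s t : List ℕ} {p w : ℕ} (hs : p = s.sum + t.sum)
    (rule : ∀ n l m, t.sum ≤ n →
      listIndex K (n + s.sum) (s ++ l) (p :: m) = w + listIndex K n l (t ++ m)) (n k : ℕ) :
    pendingCountHead K s p n k = shift s.sum w (pendingCount K t) n k := by
  rw [pendingCountHead, shift, Finset.sum_comm]
  by_cases hp : s.sum ≤ n
  · obtain ⟨n, rfl⟩ : ∃ r, n = r + s.sum := ⟨n - s.sum, by omega⟩
    have e : partListsSub (n + s.sum) s.sum = partLists n := by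
      have := partListsSub_add n s.sum 0
      rwa [add_zero, partListsSub_zero] at this
    have e1 : partListsSub (n + s.sum) p = partListsSub n t.sum := by
      rw [hs, partListsSub_add]
    have e2 : ∀ l, ∑ m ∈ partListsSub n t.sum,
        (if listIndex K (n + s.sum) (s ++ l) (p :: m) = k then (1 : ℤ) else 0) =
        ∑ m ∈ partListsSub n t.sum,
          if w ≤ k then (if listIndex K n (t ++ m) l = k - w then 1 else 0) else 0 := by
      intro l
      refine Finset.sum_congr rfl fun m hm => ?_
      rw [rule n l m (by have := (mem_partListsSub.mp hm).1; omega), ite_add_eq, listIndex_swap]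
    rw [e, e1, Finset.sum_congr rfl fun m _ => e2 m, pendingCount, Nat.add_sub_cancel]
    by_cases hw : w ≤ k
    · simp [hw]
    · simp [hw]
  · have e : partListsSub n s.sum = ∅ := if_neg hp
    rw [e, Finset.sum_empty, if_neg fun h => hp h.1]

variable [Infinite K]

theorem pendingCount_one (n k : ℕ) :
    pendingCount K [1] n k = shift 1 1 (pendingCount K []) n k +
      shift 1 0 (pendingCount K [1, 1]) n k + shift 1 0 (pendingCount K [2, 1]) n k := by
  rw [pendingCount_eq_sum_head K (by simp)]
  congr 1
  congr 1
  · refine pendingCountHead_eq_shift_of_le K (by simp) (fun n l m _ => ?_) n k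
    exact listIndex_cons_self K 1 n l m
  · refine pendingCountHead_eq_shift_of_ge K (by simp) (fun n l m hn => ?_) n k
    rw [zero_add]
    exact listIndex_of_two_mul_le K (d := 1) (a := 1) l m hn
  · refine pendingCountHead_eq_shift_of_ge K (by simp) (fun n l m hn => ?_) n k
    rw [zero_add]
    exact listIndex_of_two_mul_le K (d := 2) (a := 1) l m hn

/-- The case `d = 0` of the previous rule, with the resulting empty part dropped. -/
theorem listIndex_cons_two_mul {a n : ℕ} (l m : List ℕ) (hn : a ≤ n) :
    listIndex K (n + a) (a :: l) (2 * a :: m) = listIndex K n l (a :: m) := by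
  have := listIndex_of_two_mul_le K (d := 0) l m (n := n) (a := a) (by omega)
  rw [zero_add] at this
  rw [this, listIndex_swap, listIndex_zero_cons, listIndex_swap]

theorem pendingCount_one_one (n k : ℕ) :
    pendingCount K [1, 1] n k = shift 1 1 (pendingCount K [1]) n k +
      shift 2 1 (pendingCount K [1]) n k + shift 2 0 (pendingCount K [1, 1]) n k := by
  rw [pendingCount_eq_sum_head K (by simp)]
  congr 1
  congr 1
  · refine pendingCountHead_eq_shift_of_le K (by simp) (fun n l m _ => ?_) n k
    exact listIndex_cons_self K 1 n (1 :: l) m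
  · refine pendingCountHead_eq_shift_of_ge K (s := [1, 1]) (by simp) (fun n l m hn => ?_) n k
    simp only [List.sum_cons, List.sum_nil] at hn
    have h1 := listIndex_of_two_mul_le K (d := 1) (a := 1) (n := n + 1) (1 :: l) m (by omega)
    exact h1.trans (listIndex_cons_self K 1 n l (1 :: m))
  · refine pendingCountHead_eq_shift_of_ge K (s := [1, 1]) (by simp) (fun n l m hn => ?_) n k
    simp only [List.sum_cons, List.sum_nil] at hn
    rw [zero_add]
    have h1 := listIndex_of_two_mul_le K (d := 2) (a := 1) (n := n + 1) (1 :: l) m (by omega)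
    exact h1.trans (listIndex_cons_two_mul K l (1 :: m) (by omega))

/-- Against 1 the remainder is [1,1]. Against 3 the first parts go from 2/3 to 1/2, and the 1 left
below cancels the pending 1, contributing 1. Against 4 the part 2 leaves 2 below, which the pending
1 reduces to 1. -/
theorem pendingCount_two_one (n k : ℕ) :
    pendingCount K [2, 1] n k = shift 1 0 (pendingCount K [1, 1]) n k +
      shift 3 1 (pendingCount K []) n k + shift 3 0 (pendingCount K [1]) n k := by
  rw [pendingCount_eq_sum_head K (by simp)]
  congr 1
  congr 1
  · refine pendingCountHead_eq_shift_of_le K (by simp) (fun n l m hn => ?_) n k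
    simp only [List.sum_cons, List.sum_nil] at hn
    rw [zero_add, listIndex_swap, listIndex_swap K n]
    exact listIndex_cons_two_mul K m (1 :: l) (by omega)
  · refine pendingCountHead_eq_shift_of_le K (by simp) (fun n l m _ => ?_) n k
    have h1 := listIndex_of_lt_two_mul K (d := 1) (e := 1) (n := n + 2) (1 :: l) m (by omega)
    have h2 := listIndex_cons_two_mul K (a := 1) (n := n + 1) (1 :: l) m (by omega)
    exact h1.trans (h2.trans (listIndex_cons_self K 1 n l m))
  · refine pendingCountHead_eq_shift_of_ge K (s := [2, 1]) (by simp) (fun n l m hn => ?_) n k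
    simp only [List.sum_cons, List.sum_nil] at hn
    rw [zero_add]
    have h1 := listIndex_cons_two_mul K (a := 2) (n := n + 1) (1 :: l) m (by omega)
    exact h1.trans (listIndex_cons_two_mul K (a := 1) (n := n) l m (by omega))

/-- The first parts pass through 3/4, 2/3, 1/2, and a single 1 is left below. -/
theorem listIndex_three_four {n : ℕ} (l m : List ℕ) (hn : 1 ≤ n) :
    listIndex K (n + 3) (3 :: l) (4 :: m) = listIndex K n l (1 :: m) := by
  have h1 := listIndex_of_lt_two_mul K (d := 1) (e := 2) (n := n + 2) l m (by omega)
  have h2 := listIndex_of_lt_two_mul K (d := 1) (e := 1) (n := n + 1) l m (by omega)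
  exact h1.trans (h2.trans (listIndex_cons_two_mul K l m hn))

theorem pendingCount_three (n k : ℕ) :
    pendingCount K [3] n k = shift 1 0 (pendingCount K [1, 1]) n k +
      shift 3 3 (pendingCount K []) n k + shift 3 0 (pendingCount K [1]) n k := by
  rw [pendingCount_eq_sum_head K (by simp)]
  congr 1
  congr 1
  · refine pendingCountHead_eq_shift_of_le K (by simp) (fun n l m hn => ?_) n k
    rw [zero_add, listIndex_swap, listIndex_swap K n]
    exact listIndex_of_two_mul_le K (d := 1) (a := 1) m l hn
  · refine pendingCountHead_eq_shift_of_le K (by simp) (fun n l m _ => ?_) n k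
    exact listIndex_cons_self K 3 n l m
  · refine pendingCountHead_eq_shift_of_ge K (s := [3]) (by simp) (fun n l m hn => ?_) n k
    rw [zero_add]
    exact listIndex_three_four K l m hn

theorem pendingCount_four (n k : ℕ) :
    pendingCount K [4] n k = shift 1 0 (pendingCount K [2, 1]) n k +
      shift 3 0 (pendingCount K [1]) n k + shift 4 4 (pendingCount K []) n k := by
  rw [pendingCount_eq_sum_head K (by simp)]
  congr 1
  congr 1
  · refine pendingCountHead_eq_shift_of_le K (by simp) (fun n l m hn => ?_) n k
    rw [zero_add, listIndex_swap, listIndex_swap K n]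
    exact listIndex_of_two_mul_le K (d := 2) (a := 1) m l hn
  · refine pendingCountHead_eq_shift_of_le K (by simp) (fun n l m hn => ?_) n k
    rw [zero_add, listIndex_swap, listIndex_swap K n]
    exact listIndex_three_four K m l hn
  · refine pendingCountHead_eq_shift_of_le K (by simp) (fun n l m _ => ?_) n k
    exact listIndex_cons_self K 4 n l m

end Counting

/-! ### Generating series and the solution of the transfer system. -/

section Series

/-- The power series in `x` and `y` with coefficients `a n k`. -/
noncomputable def series (a : ℕ → ℕ → ℤ) : MvPowerSeries (Fin 2) ℤ := fun d => a (d 0) (d 1)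

theorem coeff_series (a : ℕ → ℕ → ℤ) (d : Fin 2 →₀ ℕ) : coeff d (series a) = a (d 0) (d 1) := rfl

theorem X_pow_mul_X_pow_mul_series (i j : ℕ) (a : ℕ → ℕ → ℤ) :
    X 0 ^ i * X 1 ^ j * series a = series (shift i j a) := by
  ext d
  have e : (X 0 ^ i * X 1 ^ j : MvPowerSeries (Fin 2) ℤ) =
      monomial (Finsupp.single 0 i + Finsupp.single 1 j) 1 := by
    rw [X_pow_eq, X_pow_eq, monomial_mul_monomial, one_mul]
  have hle : Finsupp.single 0 i + Finsupp.single 1 j ≤ d ↔ i ≤ d 0 ∧ j ≤ d 1 := by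
    rw [Finsupp.le_def, Fin.forall_fin_two]
    simp
  rw [e, coeff_monomial_mul, coeff_series (shift i j a), shift]
  by_cases h : i ≤ d 0 ∧ j ≤ d 1
  · rw [if_pos (hle.mpr h), if_pos h, one_mul, coeff_series]
    simp
  · rw [if_neg fun h' => h (hle.mp h'), if_neg h]

theorem series_one : series (fun n k => if n = 0 ∧ k = 0 then 1 else 0) = 1 := by
  ext d
  rw [coeff_series, coeff_one]
  refine if_congr ?_ rfl rfl
  rw [Finsupp.ext_iff, Fin.forall_fin_two]
  rfl

variable (K : Type*) [Field K] [Infinite K]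

/-- The transfer system, solved by Cramer's rule. -/
theorem series_pendingCount_nil_mul_denom134 :
    series (pendingCount K []) * denom134 = numer134 := by
  set G₀ := series (pendingCount K [])
  set G₁ := series (pendingCount K [1])
  set G₁₁ := series (pendingCount K [1, 1])
  set G₂₁ := series (pendingCount K [2, 1])
  set G₃ := series (pendingCount K [3])
  set G₄ := series (pendingCount K [4])
  set x : MvPowerSeries (Fin 2) ℤ := X 0 with hx
  set y : MvPowerSeries (Fin 2) ℤ := X 1 with hy
  have e₀ : G₀ = 1 + G₁ + G₃ + G₄ := by
    rw [← series_one]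
    exact congrArg series (funext₂ (pendingCount_nil K))
  have e₁ : G₁ = x ^ 1 * y ^ 1 * G₀ + x ^ 1 * y ^ 0 * G₁₁ + x ^ 1 * y ^ 0 * G₂₁ := by
    simp only [G₀, G₁₁, G₂₁, hx, hy, X_pow_mul_X_pow_mul_series]
    exact congrArg series (funext₂ (pendingCount_one K))
  have e₁₁ : G₁₁ = x ^ 1 * y ^ 1 * G₁ + x ^ 2 * y ^ 1 * G₁ + x ^ 2 * y ^ 0 * G₁₁ := by
    conv_rhs => simp only [G₁, G₁₁, hx, hy, X_pow_mul_X_pow_mul_series]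
    exact congrArg series (funext₂ (pendingCount_one_one K))
  have e₂₁ : G₂₁ = x ^ 1 * y ^ 0 * G₁₁ + x ^ 3 * y ^ 1 * G₀ + x ^ 3 * y ^ 0 * G₁ := by
    simp only [G₀, G₁, G₁₁, hx, hy, X_pow_mul_X_pow_mul_series]
    exact congrArg series (funext₂ (pendingCount_two_one K))
  have e₃ : G₃ = x ^ 1 * y ^ 0 * G₁₁ + x ^ 3 * y ^ 3 * G₀ + x ^ 3 * y ^ 0 * G₁ := by
    simp only [G₀, G₁, G₁₁, hx, hy, X_pow_mul_X_pow_mul_series]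
    exact congrArg series (funext₂ (pendingCount_three K))
  have e₄ : G₄ = x ^ 1 * y ^ 0 * G₂₁ + x ^ 3 * y ^ 0 * G₁ + x ^ 4 * y ^ 4 * G₀ := by
    simp only [G₀, G₁, G₂₁, hx, hy, X_pow_mul_X_pow_mul_series]
    exact congrArg series (funext₂ (pendingCount_four K))
  -- `D` is the determinant of the system and `c` the cofactor of the entry of `G₀` in `e₀`. They
  -- equal (1 + x)² g and (1 + x)² f, hence the cross-multiplication in `h₂`.
  set c : MvPowerSeries (Fin 2) ℤ :=
    1 - x ^ 2 - x ^ 2 * y - 2 * x ^ 3 * y - x ^ 4 - x ^ 4 * y + x ^ 6 with hc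
  set D : MvPowerSeries (Fin 2) ℤ :=
    1 - x * y - x ^ 2 - x ^ 2 * y - x ^ 3 * y - x ^ 3 * y ^ 2 - x ^ 3 * y ^ 3 - x ^ 4
      - 5 * x ^ 4 * y - 2 * x ^ 4 * y ^ 2 - x ^ 4 * y ^ 4 - x ^ 5 * y - x ^ 5 * y ^ 2
      + x ^ 5 * y ^ 3 + x ^ 5 * y ^ 4 + x ^ 6 + 4 * x ^ 6 * y + 3 * x ^ 6 * y ^ 4 + x ^ 6 * y ^ 5
      - x ^ 7 * y + x ^ 7 * y ^ 3 + x ^ 7 * y ^ 4 + 2 * x ^ 7 * y ^ 5 + x ^ 8 * y ^ 4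
      + x ^ 8 * y ^ 5 + 2 * x ^ 9 * y - x ^ 9 * y ^ 3 - x ^ 10 * y ^ 4 with hD
  have hD0 : D ≠ 0 := by
    intro h
    have := congrArg constantCoeff h
    simp [hD, hx, hy] at this
  have h₁ : G₀ * D = c := by
    rw [hD, hc]
    -- The multipliers are the cofactors of the column of `G₀`.
    linear_combination (1 - x ^ 2 - x ^ 2 * y - 2 * x ^ 3 * y - x ^ 4 - x ^ 4 * y + x ^ 6) * e₀ +
      (1 - x ^ 2 + x ^ 2 * y + 2 * x ^ 3 + 2 * x ^ 3 * y + x ^ 4 + x ^ 4 * y - 2 * x ^ 5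
        - x ^ 6) * e₁ +
      (2 * x + 2 * x ^ 2 + 2 * x ^ 4 + 2 * x ^ 5) * e₁₁ +
      (2 * x - 2 * x ^ 3 + 2 * x ^ 4 - 2 * x ^ 6) * e₂₁ +
      (1 - x ^ 2 - x ^ 2 * y - 2 * x ^ 3 * y - x ^ 4 - x ^ 4 * y + x ^ 6) * e₃ +
      (1 - x ^ 2 - x ^ 2 * y - 2 * x ^ 3 * y - x ^ 4 - x ^ 4 * y + x ^ 6) * e₄
  have h₂ : c * denom134 = numer134 * D := by
    rw [denom134, numer134, hc, hD]
    ring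
  apply mul_right_cancel₀ hD0
  rw [mul_right_comm, h₁, h₂]

theorem isUnit_denom134 : IsUnit denom134 := by
  rw [isUnit_iff_constantCoeff]
  simp [denom134]

end Series

/-! ### Counting meanders with parts c, 3c, 4c. -/

section Final

variable (K : Type*) [Field K]

theorem exists_map_mul_eq {c : ℕ} (l : List ℕ) (h : ∀ p ∈ l, p ∈ ({c, 3 * c, 4 * c} : Set ℕ)) :
    ∃ l' : List ℕ, (∀ p ∈ l', p = 1 ∨ p = 3 ∨ p = 4) ∧ l'.map (c * ·) = l := by
  induction l with
  | nil => exact ⟨[], by simp, rfl⟩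
  | cons a l ih =>
    obtain ⟨l', h1, h2⟩ := ih fun p hp => h p (List.mem_cons_of_mem _ hp)
    have ha := h a List.mem_cons_self
    simp only [Set.mem_insert_iff, Set.mem_singleton_iff] at ha
    obtain ⟨q, hq, hqa⟩ : ∃ q, (q = 1 ∨ q = 3 ∨ q = 4) ∧ c * q = a := by
      rcases ha with rfl | rfl | rfl
      · exact ⟨1, by simp, by ring⟩
      · exact ⟨3, by simp, by ring⟩
      · exact ⟨4, by simp, by ring⟩
    refine ⟨q :: l', ?_, by simp [h2, hqa]⟩
    simpa [hq] using h1

theorem meanderCount_of_not_dvd {c N k : ℕ} (hc : ¬ c ∣ N) :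
    meanderCount K {c, 3 * c, 4 * c} N k = 0 := by
  rw [meanderCount, Nat.card_eq_zero]
  left
  constructor
  rintro ⟨m, h, -⟩
  obtain ⟨l, -, hl⟩ := exists_map_mul_eq _ h
  apply hc
  rw [← m.1.blocks_sum, ← hl, List.sum_map_mul_left]
  exact dvd_mul_right _ _

variable [Infinite K]

/-- Dividing all parts by `c` is a bijection onto pairs of lists of parts 1, 3, 4, and it divides
the index by `c`. -/
theorem meanderCount_mul {c : ℕ} (hc : 1 ≤ c) (n k : ℕ) :
    (meanderCount K {c, 3 * c, 4 * c} (c * n) k : ℤ) =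
      ∑ m ∈ partLists n, ∑ l ∈ partLists n, if c * listIndex K n l m = k then 1 else 0 := by
  -- Pairs in `S` list the lower parts first, as in the order of summation; `F` exchanges the two
  -- entries.
  let S := (partLists n ×ˢ partLists n).filter fun z => c * listIndex K n z.2 z.1 = k
  have hS : ∀ z ∈ S, (z.1.sum = n ∧ ∀ p ∈ z.1, p = 1 ∨ p = 3 ∨ p = 4) ∧
      (z.2.sum = n ∧ ∀ p ∈ z.2, p = 1 ∨ p = 3 ∨ p = 4) ∧ c * listIndex K n z.2 z.1 = k := by
    intro z hz
    obtain ⟨h1, h2⟩ := Finset.mem_filter.mp hz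
    obtain ⟨h3, h4⟩ := Finset.mem_product.mp h1
    exact ⟨mem_partLists.mp h3, mem_partLists.mp h4, h2⟩
  have comp : ∀ l : List ℕ, (l.sum = n ∧ ∀ p ∈ l, p = 1 ∨ p = 3 ∨ p = 4) →
      ∃ lam : Composition (c * n), lam.blocks = l.map (c * ·) := by
    rintro l ⟨h1, h2⟩
    refine ⟨⟨l.map (c * ·), ?_, ?_⟩, rfl⟩
    · intro p hp
      obtain ⟨q, hq, rfl⟩ := List.mem_map.mp hp
      have := h2 q hq
      exact Nat.mul_pos hc (by omega)
    · rw [List.sum_map_mul_left, List.map_id', h1]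
  have parts : ∀ l : List ℕ, (∀ p ∈ l, p = 1 ∨ p = 3 ∨ p = 4) →
      ∀ p ∈ l.map (c * ·), p ∈ ({c, 3 * c, 4 * c} : Set ℕ) := by
    intro l hl p hp
    obtain ⟨q, hq, rfl⟩ := List.mem_map.mp hp
    rcases hl q hq with rfl | rfl | rfl <;> simp [mul_comm]
  choose! toComp hcomp using comp
  have hinj : Function.Injective (List.map (c * ·)) :=
    List.map_injective_iff.mpr fun a b hab => Nat.eq_of_mul_eq_mul_left hc hab
  let F : S → {m : Meander (c * n) // (∀ p ∈ m.1.blocks, p ∈ ({c, 3 * c, 4 * c} : Set ℕ)) ∧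
      (∀ p ∈ m.2.blocks, p ∈ ({c, 3 * c, 4 * c} : Set ℕ)) ∧ meanderIndex K m = k} := fun z =>
    ⟨(toComp z.1.2, toComp z.1.1), by
      obtain ⟨h1, h2, h3⟩ := hS z.1 z.2
      rw [meanderIndex_eq_listIndex, hcomp _ h1, hcomp _ h2,
        listIndex_map_mul K c n _ _ h2.1 h1.1]
      exact ⟨parts _ h2.2, parts _ h1.2, h3⟩⟩
  have hF : Function.Bijective F := by
    constructor
    · intro z w hzw
      obtain ⟨h1, h2, -⟩ := hS z.1 z.2
      obtain ⟨h3, h4, -⟩ := hS w.1 w.2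
      have e := congrArg Subtype.val hzw
      have e1 : toComp z.1.2 = toComp w.1.2 := congrArg Prod.fst e
      have e2 : toComp z.1.1 = toComp w.1.1 := congrArg Prod.snd e
      apply Subtype.ext
      apply Prod.ext
      · apply hinj
        rw [← hcomp _ h1, ← hcomp _ h3, e2]
      · apply hinj
        rw [← hcomp _ h2, ← hcomp _ h4, e1]
    · rintro ⟨⟨lam, mu⟩, h1, h2, h3⟩
      obtain ⟨l, hl, hlb⟩ := exists_map_mul_eq _ h1
      obtain ⟨m, hm, hmb⟩ := exists_map_mul_eq _ h2
      have hsum : ∀ (t : List ℕ) (ν : Composition (c * n)), t.map (c * ·) = ν.blocks →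
          t.sum = n := by
        intro t ν ht
        have := ν.blocks_sum
        rw [← ht, List.sum_map_mul_left, List.map_id'] at this
        exact Nat.eq_of_mul_eq_mul_left hc this
      have hls := hsum l lam hlb
      have hms := hsum m mu hmb
      have hmem : (m, l) ∈ S := by
        rw [Finset.mem_filter, Finset.mem_product, mem_partLists, mem_partLists]
        refine ⟨⟨⟨hms, hm⟩, hls, hl⟩, ?_⟩
        rw [meanderIndex_eq_listIndex] at h3
        rw [← h3, ← listIndex_map_mul K c n l m hls hms, hlb, hmb]
      refine ⟨⟨(m, l), hmem⟩, Subtype.ext (Prod.ext ?_ ?_)⟩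
      · exact Composition.ext ((hcomp l ⟨hls, hl⟩).trans hlb)
      · exact Composition.ext ((hcomp m ⟨hms, hm⟩).trans hmb)
  rw [meanderCount, ← Nat.card_congr (Equiv.ofBijective F hF), Nat.card_eq_fintype_card,
    Fintype.card_coe, Finset.card_filter, Finset.sum_product]
  push_cast
  rfl

theorem meanderSeries_eq_series : meanderSeries K {1, 3, 4} = series (pendingCount K []) := by
  ext d
  -- The case `c = 1`.
  have h := meanderCount_mul K le_rfl (d 0) (d 1)
  simp only [one_mul, mul_one] at h
  refine h.trans ?_
  rw [coeff_series, pendingCount]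
  simp only [List.sum_nil, partListsSub_zero, List.nil_append]

theorem meanderSeries_mul_eq_expand {c : ℕ} (hc : 1 ≤ c) :
    meanderSeries K {c, 3 * c, 4 * c} =
      expand c (Nat.one_le_iff_ne_zero.mp hc) (meanderSeries K {1, 3, 4}) := by
  have hc0 : c ≠ 0 := Nat.one_le_iff_ne_zero.mp hc
  ext d
  change (meanderCount K {c, 3 * c, 4 * c} (d 0) (d 1) : ℤ) = _
  by_cases h0 : c ∣ d 0
  swap
  · rw [meanderCount_of_not_dvd K h0, coeff_expand_of_not_dvd c hc0 _ h0, Nat.cast_zero]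
  obtain ⟨n, hn⟩ := h0
  rw [hn, meanderCount_mul K hc]
  by_cases h1 : c ∣ d 1
  · obtain ⟨k, hk⟩ := h1
    have hd : d = c • (Finsupp.single 0 n + Finsupp.single 1 k) := by
      rw [Finsupp.ext_iff, Fin.forall_fin_two]
      simp [hn, hk]
    conv_rhs => rw [hd, coeff_expand_smul, meanderSeries_eq_series, coeff_series]
    simp only [pendingCount, List.sum_nil, partListsSub_zero, List.nil_append, hk,
      Nat.mul_right_inj hc0]
    simp
  · rw [coeff_expand_of_not_dvd c hc0 _ h1]
    refine Finset.sum_eq_zero fun m _ => Finset.sum_eq_zero fun l _ => if_neg ?_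
    rintro h
    exact h1 ⟨_, h.symm⟩

end Final

end SeaweedMeander

/-- The quotient `f / g` is taken in `ℤ⟦x, y⟧`, where `g` is invertible. The series
`MvPowerSeries.expand c _ A` is `A(x ^ c, y ^ c)`. -/
theorem mainTheorem11 (K : Type*) [Field K] [CharZero K] :
    (IsUnit SeaweedMeander.denom134 ∧
      SeaweedMeander.meanderSeries K {1, 3, 4} * SeaweedMeander.denom134 =
        SeaweedMeander.numer134) ∧
    ∀ (c : ℕ) (hc : 1 ≤ c),
      SeaweedMeander.meanderSeries K {c, 3 * c, 4 * c} =
        MvPowerSeries.expand c (Nat.one_le_iff_ne_zero.mp hc)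
          (SeaweedMeander.meanderSeries K {1, 3, 4}) := by
  refine ⟨⟨SeaweedMeander.isUnit_denom134, ?_⟩,
    fun c hc => SeaweedMeander.meanderSeries_mul_eq_expand K hc⟩
  rw [SeaweedMeander.meanderSeries_eq_series]
  exact SeaweedMeander.series_pendingCount_nil_mul_denom134 K
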